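/- Let $M$ be a smooth connected manifold of dimension $n>2$, let $T_0M$ be its tangent bundle with the zero section removed, and let $J=dx^i\otimes\partial/\partial y^i$ be the vertical endomorphism in the induced coordinates $(x^i,y^i)$. Let $F:TM\to\mathbb R$ be a Finsler metric: $F$ is continuous, positive and smooth on $T_0M$, satisfies $F(x,\lambda y)=\lambda F(x,y)$ for all $\lambda>0$, and its metric tensor $g_{ij}=\frac12\,\partial^2F^2/\partial y^i\partial y^j$ is non-degenerate on $T_0M$. Let $S$ be the geodesic spray of $F$, that is, the unique vector field on $T_0M$ with $i_S\,dd_JF^2=-dF^2$; let $h=\frac12(\mathrm{Id}-[S,J])$ be the horizontal projector and $R=\frac12[h,h]$ the curvature tensor (Frölicher–Nijenhuis brackets), a vector-valued semi-basic $2$-form on $T_0M$ with components given by $R(\partial/\partial x^j,\partial/\partial x^k)=R^l_{jk}\,\partial/\partial y^l$. One says that $F$ has constant flag curvature if there is a constant $\kappa\in\mathbb R$ such that $$\frac{X^i g_{il}R^l_{jk}y^jX^k}{g_{ij}y^iy^j\,g_{ij}X^iX^j-(g_{ij}y^iX^j)^2}=\kappa$$ for all $(x,y)\in T_0M$ and all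 $X\in T_xM$ linearly independent of $y$. Then $F$ has constant flag curvature if and only if there exists a smooth semi-basic $1$-form $\xi$ on $T_0M$ (that is, a $1$-form vanishing on vertical vectors) such that $R=\xi\wedge J$, i.e. $R(U,W)=\xi(U)\,JW-\xi(W)\,JU$ for all vector fields $U,W$ on $T_0M$. -/

import Mathlib

open scoped Manifold ContDiff Topology
open VectorField (lieBracket)

namespace Finsler

noncomputable section

/-! ### Calculus in induced coordinates

`E × E` carries the coordinates `z = (x, y)` induced on the tangent bundle by a chart with values
in `E`, and `f : E × E → ℝ` is the Finsler function in these coordinates. Vector fields are maps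
`E × E → E × E`, and tensors act on tangent vectors `u, w : E × E`. All operators below are local,
so at a point of an open set they only see the restriction of `f` to that set. -/

section Local

variable {E : Type*} [NormedAddCommGroup E] [NormedSpace ℝ E]

/-- The vertical endomorphism `J = dxⁱ ⊗ ∂/∂yⁱ`. -/
def vertEndo : (E × E) →L[ℝ] (E × E) :=
  (ContinuousLinearMap.inr ℝ E E).comp (ContinuousLinearMap.fst ℝ E E)

/-- The metric tensor `g_{ij} = (1/2) ∂²F²/∂yⁱ∂yʲ`, at `z` and applied to `a = aⁱ`, `b = bʲ`. -/
def metric (f : E × E → ℝ) (z : E × E) (a b : E) : ℝ :=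
  (1 / 2) * fderiv ℝ (fderiv ℝ fun p => f p ^ 2) z (0, a) (0, b)

/-- The `1`-form `d_J L = dL ∘ J`. -/
def dJ (L : E × E → ℝ) (z : E × E) : (E × E) →L[ℝ] ℝ :=
  (fderiv ℝ L z).comp vertEndo

/-- The exterior derivative of a `1`-form. -/
def dOne (α : E × E → ((E × E) →L[ℝ] ℝ)) (z u w : E × E) : ℝ :=
  fderiv ℝ α z u w - fderiv ℝ α z w u

/-- The geodesic spray: `S z` is the vector with `i_S dd_J F² = -dF²`. It exists and is unique
where the metric tensor is non-degenerate. -/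
def geodesicSpray (f : E × E → ℝ) (z : E × E) : E × E :=
  Classical.epsilon fun s : E × E =>
    ∀ w : E × E, dOne (dJ fun p => f p ^ 2) z s w = -fderiv ℝ (fun p => f p ^ 2) z w

/-- The Frölicher-Nijenhuis bracket `[X, K]` of a vector field and a vector valued `1`-form,
applied to the vector field `Y`, that is `[X, K Y] - K [X, Y]`. -/
def fnBracketField (X : E × E → E × E) (K : E × E → E × E → E × E) (Y : E × E → E × E) :
    E × E → E × E := fun z =>
  lieBracket ℝ X (fun p => K p (Y p)) z - K z (lieBracket ℝ X Y z)

/-- The Frölicher-Nijenhuis bracket `[K, L]` of two vector valued `1`-forms, applied to the vector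
fields `X` and `Y`. -/
def fnBracket (K L : E × E → E × E → E × E) (X Y : E × E → E × E) : E × E → E × E := fun z =>
  lieBracket ℝ (fun p => K p (X p)) (fun p => L p (Y p)) z
    + lieBracket ℝ (fun p => L p (X p)) (fun p => K p (Y p)) z
    + K z (L z (lieBracket ℝ X Y z)) + L z (K z (lieBracket ℝ X Y z))
    - K z (lieBracket ℝ (fun p => L p (X p)) Y z) - K z (lieBracket ℝ X (fun p => L p (Y p)) z)
    - L z (lieBracket ℝ (fun p => K p (X p)) Y z) - L z (lieBracket ℝ X (fun p => K p (Y p)) z)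

/-- The horizontal projector `h = (1/2) (Id - [S, J])`. Being a tensor, it is evaluated at a tangent
vector `u` through the constant vector field `u`. -/
def horProj (f : E × E → ℝ) (z u : E × E) : E × E :=
  (1 / 2 : ℝ) • (u - fnBracketField (geodesicSpray f) (fun _ => vertEndo) (fun _ => u) z)

/-- The curvature tensor `R = (1/2) [h, h]` of the horizontal distribution, evaluated at tangent
vectors `u`, `w` through the constant vector fields `u`, `w`. -/
def curvature (f : E × E → ℝ) (z u w : E × E) : E × E :=
  (1 / 2 : ℝ) • fnBracket (horProj f) (horProj f) (fun _ => u) (fun _ => w) z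

/-- The flag curvature of the flag with flagpole `y` and plane `span {y, X}`, at `z = (x, y)`:
`Xⁱ g_{il} Rˡ_{jk} yʲ Xᵏ / (g_{ij} yⁱ yʲ g_{ij} Xⁱ Xʲ - (g_{ij} yⁱ Xʲ)²)`, where
`Rˡ_{jk}` are the components of `R (∂/∂xʲ, ∂/∂xᵏ) = Rˡ_{jk} ∂/∂yˡ`. -/
def flagCurvature (f : E × E → ℝ) (z : E × E) (X : E) : ℝ :=
  metric f z X (curvature f z (z.2, 0) (X, 0)).2 /
    (metric f z z.2 z.2 * metric f z X X - metric f z z.2 X ^ 2)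

end Local

/-! ### Finsler metrics on a manifold -/

section Global

variable {n : ℕ} {M : Type*} [TopologicalSpace M] [ChartedSpace (EuclideanSpace ℝ (Fin n)) M]

/-- The inverse of the bundle chart of `TM` induced by a chart `φ` of `M`: it sends `(x, y)` to the
tangent vector `yⁱ ∂/∂xⁱ` at the point with coordinates `x`. -/
def bundleParam (φ : OpenPartialHomeomorph M (EuclideanSpace ℝ (Fin n)))
    (z : EuclideanSpace ℝ (Fin n) × EuclideanSpace ℝ (Fin n)) : TangentBundle (𝓡 n) M :=
  ⟨φ.symm z.1, mfderiv (𝓡 n) (𝓡 n) φ.symm z.1 z.2⟩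

/-- The coordinate domain of `T₀M` (nonzero tangent vectors) induced by a chart of `M`. -/
def slitDomain (φ : OpenPartialHomeomorph M (EuclideanSpace ℝ (Fin n))) :
    Set (EuclideanSpace ℝ (Fin n) × EuclideanSpace ℝ (Fin n)) :=
  {z | z.1 ∈ φ.target ∧ z.2 ≠ 0}

/-- A function on `TM` in the coordinates induced by `φ`. -/
def inChart (F : TangentBundle (𝓡 n) M → ℝ)
    (φ : OpenPartialHomeomorph M (EuclideanSpace ℝ (Fin n))) :
    EuclideanSpace ℝ (Fin n) × EuclideanSpace ℝ (Fin n) → ℝ :=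
  fun z => F (bundleParam φ z)

variable [IsManifold (𝓡 n) ∞ M]

/-- Finsler metrics. The function is positive on `T₀M`; it vanishes on the zero section by
homogeneity. -/
structure IsFinslerMetric (F : TangentBundle (𝓡 n) M → ℝ) : Prop where
  continuous : Continuous F
  pos : ∀ z : TangentBundle (𝓡 n) M, z.2 ≠ 0 → 0 < F z
  smooth : ContMDiffOn (𝓡 n).tangent 𝓘(ℝ, ℝ) ∞ F {z | z.2 ≠ 0}
  homogeneous : ∀ (p : M) (v : TangentSpace (𝓡 n) p) (c : ℝ), 0 < c →
    F ⟨p, c • v⟩ = c * F ⟨p, v⟩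
  nondegenerate : ∀ φ ∈ IsManifold.maximalAtlas (𝓡 n) ∞ M, ∀ z ∈ slitDomain φ,
    ∀ a : EuclideanSpace ℝ (Fin n), (∀ b, metric (inChart F φ) z a b = 0) → a = 0

/-- The flag curvature is one and the same constant for all flags. -/
def HasConstantFlagCurvature (F : TangentBundle (𝓡 n) M → ℝ) : Prop :=
  ∃ κ : ℝ, ∀ φ ∈ IsManifold.maximalAtlas (𝓡 n) ∞ M, ∀ z ∈ slitDomain φ,
    ∀ X : EuclideanSpace ℝ (Fin n), LinearIndependent ℝ ![z.2, X] →
      flagCurvature (inChart F φ) z X = κ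

/-- A `1`-form on `TM` in the coordinates induced by `φ`, that is, its pullback by
`bundleParam φ`. -/
def formInChart (ξ : ∀ z : TangentBundle (𝓡 n) M, TangentSpace (𝓡 n).tangent z →L[ℝ] ℝ)
    (φ : OpenPartialHomeomorph M (EuclideanSpace ℝ (Fin n)))
    (z u : EuclideanSpace ℝ (Fin n) × EuclideanSpace ℝ (Fin n)) : ℝ :=
  ξ (bundleParam φ z)
    (mfderiv 𝓘(ℝ, EuclideanSpace ℝ (Fin n) × EuclideanSpace ℝ (Fin n)) (𝓡 n).tangent
      (bundleParam φ) z u)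

/-- Smooth semi-basic `1`-forms on `T₀M`: they vanish on the vertical distribution `Ker Dπ`.
Values on the zero section are irrelevant. -/
structure IsSemiBasicOneForm
    (ξ : ∀ z : TangentBundle (𝓡 n) M, TangentSpace (𝓡 n).tangent z →L[ℝ] ℝ) : Prop where
  smooth : ∀ φ ∈ IsManifold.maximalAtlas (𝓡 n) ∞ M,
    ∀ u, ContDiffOn ℝ ∞ (fun z => formInChart ξ φ z u) (slitDomain φ)
  semiBasic : ∀ z : TangentBundle (𝓡 n) M, z.2 ≠ 0 → ∀ u : TangentSpace (𝓡 n).tangent z,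
    mfderiv (𝓡 n).tangent (𝓡 n) (fun p : TangentBundle (𝓡 n) M => p.proj) z u = 0 → ξ z u = 0

/-- The identity `R = ξ ∧ J` of vector valued `2`-forms on `T₀M`, where
`(ξ ∧ J)(u, w) = ξ(u) J w - ξ(w) J u`. -/
def CurvatureEqWedge (F : TangentBundle (𝓡 n) M → ℝ)
    (ξ : ∀ z : TangentBundle (𝓡 n) M, TangentSpace (𝓡 n).tangent z →L[ℝ] ℝ) : Prop :=
  ∀ φ ∈ IsManifold.maximalAtlas (𝓡 n) ∞ M, ∀ z ∈ slitDomain φ,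
    ∀ u w : EuclideanSpace ℝ (Fin n) × EuclideanSpace ℝ (Fin n),
      curvature (inChart F φ) z u w =
        formInChart ξ φ z u • vertEndo w - formInChart ξ φ z w • vertEndo u

end Global

end

end Finsler

/-!
In induced coordinates `z = (x, y)` put `L = F²`, let `S = (y, s)` be the geodesic spray and let
`δ_a = (a, (1/2) ∂_y s · a)` be the horizontal lift of a constant vector `a`; then
`[δ_a, δ_b] = (0, R(a, b))` is the curvature (`IsLocalSpray.curvature_eq`). Write
`y_♭ = (1/2) ∂L/∂y = g(y, ·)`. Everything follows from a few identities, proved by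
differentiating the Euler-Lagrange equation and from the Jacobi identity: the energy is
horizontally constant (`energy_horLift`), hence `y_♭ ∘ R = 0` (`energy_horCurv`); the two Bianchi
identities (`bianchi_vert`, `bianchi_hor`); and the homogeneity of `R` (`horCurv_homogeneous`).

The metric tensor, assumed to be only nondegenerate, is positive definite: it is so where `F²`
attains its minimum on a Euclidean unit sphere of the fibre, and a fibre without its origin is
connected (`hess_pos`). Therefore the denominators of flag curvatures never vanish.

If the flag curvature is `κ`, polarization determines the self-adjoint Jacobi endomorphism
`R(y, X) = κ (L X - y_♭(X) y)`. By the vertical Bianchi identity and homogeneity `3 R` is its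
antisymmetrized fibre derivative, so `R = κ y_♭ ∧ J` (`horCurv_eq_of_jacobi`), and `κ y_♭` is the
global form `(κ / 2) d_J F²`.

If conversely `R = ξ ∧ J`, then `y_♭ ∘ R = 0` gives `ξ = ρ y_♭`, and the flag curvature is the
function `ρ`. In dimension at least three the vertical Bianchi identity shows that `ρ` depends on
`x` only, and the horizontal one that `dρ` is a multiple of `y_♭` for every `y`; as `y_♭` varies
along the fibre, `dρ = 0` (`fderiv_eq_zero_of_wedge`). Since `ρ = ξ(S) / F²` does not depend on the
coordinates and `M` is connected, `ρ` is a constant.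
-/

namespace Finsler

/-! ### Calculus on an open set -/

section Calculus

variable {V F : Type*} [NormedAddCommGroup V] [NormedSpace ℝ V] [NormedAddCommGroup F]
  [NormedSpace ℝ F] {Ω : Set V} {g : V → F} {X Y : V → V} {z : V}

theorem minSmoothness_two_le_infty : minSmoothness ℝ 2 ≤ (∞ : WithTop ℕ∞) := by
  rw [minSmoothness_of_isRCLikeNormedField]
  exact WithTop.coe_le_coe.mpr (le_top : (2 : ℕ∞) ≤ ⊤)

theorem differentiableAt_of_contDiffOn (hΩ : IsOpen Ω) (hg : ContDiffOn ℝ ∞ g Ω) (hz : z ∈ Ω) :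
    DifferentiableAt ℝ g z :=
  (hg.contDiffAt (hΩ.mem_nhds hz)).differentiableAt (by simp)

theorem contDiffOn_fderiv (hΩ : IsOpen Ω) (hg : ContDiffOn ℝ ∞ g Ω) :
    ContDiffOn ℝ ∞ (fderiv ℝ g) Ω :=
  hg.fderiv_of_isOpen hΩ (by simp)

theorem contDiffOn_fderiv_apply (hΩ : IsOpen Ω) (hg : ContDiffOn ℝ ∞ g Ω)
    (hX : ContDiffOn ℝ ∞ X Ω) : ContDiffOn ℝ ∞ (fun p => fderiv ℝ g p (X p)) Ω :=
  (contDiffOn_fderiv hΩ hg).clm_apply hX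

theorem fderiv_eq_of_eqOn {g' : V → F} (hΩ : IsOpen Ω) (h : Set.EqOn g g' Ω) (hz : z ∈ Ω) :
    fderiv ℝ g z = fderiv ℝ g' z :=
  (h.eventuallyEq_of_mem (hΩ.mem_nhds hz)).fderiv_eq

theorem fderiv_fderiv_apply (hΩ : IsOpen Ω) (hg : ContDiffOn ℝ ∞ g Ω) (hX : ContDiffOn ℝ ∞ X Ω)
    (hz : z ∈ Ω) (v : V) :
    fderiv ℝ (fun p => fderiv ℝ g p (X p)) z v =
      fderiv ℝ (fderiv ℝ g) z v (X z) + fderiv ℝ g z (fderiv ℝ X z v) := by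
  rw [fderiv_clm_apply (differentiableAt_of_contDiffOn hΩ (contDiffOn_fderiv hΩ hg) hz)
    (differentiableAt_of_contDiffOn hΩ hX hz)]
  simp [add_comm]

theorem fderiv_fderiv_const (hΩ : IsOpen Ω) (hg : ContDiffOn ℝ ∞ g Ω) (hz : z ∈ Ω) (u v : V) :
    fderiv ℝ (fun p => fderiv ℝ g p u) z v = fderiv ℝ (fderiv ℝ g) z v u := by
  simpa using fderiv_fderiv_apply (X := fun _ => u) hΩ hg contDiffOn_const hz v

theorem fderiv_fderiv_comm (hΩ : IsOpen Ω) (hg : ContDiffOn ℝ ∞ g Ω) (hz : z ∈ Ω) (u v : V) :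
    fderiv ℝ (fderiv ℝ g) z u v = fderiv ℝ (fderiv ℝ g) z v u :=
  ((hg.contDiffAt (hΩ.mem_nhds hz)).isSymmSndFDerivAt minSmoothness_two_le_infty) u v

/-- A Lie bracket acts on functions as the commutator of the two derivations. -/
theorem fderiv_lieBracket (hΩ : IsOpen Ω) (hg : ContDiffOn ℝ ∞ g Ω) (hX : ContDiffOn ℝ ∞ X Ω)
    (hY : ContDiffOn ℝ ∞ Y Ω) (hz : z ∈ Ω) :
    fderiv ℝ g z (lieBracket ℝ X Y z) =
      fderiv ℝ (fun p => fderiv ℝ g p (Y p)) z (X z)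
        - fderiv ℝ (fun p => fderiv ℝ g p (X p)) z (Y z) := by
  rw [fderiv_fderiv_apply hΩ hg hX hz, fderiv_fderiv_apply hΩ hg hY hz,
    fderiv_fderiv_comm hΩ hg hz (Y z), VectorField.lieBracket, map_sub]
  abel

theorem lieBracket_jacobi {Z : V → V} (hΩ : IsOpen Ω) (hX : ContDiffOn ℝ ∞ X Ω)
    (hY : ContDiffOn ℝ ∞ Y Ω) (hZ : ContDiffOn ℝ ∞ Z Ω) (hz : z ∈ Ω) :
    lieBracket ℝ X (lieBracket ℝ Y Z) z =
      lieBracket ℝ (lieBracket ℝ X Y) Z z + lieBracket ℝ Y (lieBracket ℝ X Z) z :=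
  VectorField.leibniz_identity_lieBracket (n := ∞) minSmoothness_two_le_infty
    (hX.contDiffAt (hΩ.mem_nhds hz)) (hY.contDiffAt (hΩ.mem_nhds hz))
    (hZ.contDiffAt (hΩ.mem_nhds hz))

theorem lieBracket_eq_of_eqOn {X' Y' : V → V} (hΩ : IsOpen Ω) (hX : Set.EqOn X X' Ω)
    (hY : Set.EqOn Y Y' Ω) (hz : z ∈ Ω) : lieBracket ℝ X Y z = lieBracket ℝ X' Y' z := by
  simp only [VectorField.lieBracket, fderiv_eq_of_eqOn hΩ hX hz, fderiv_eq_of_eqOn hΩ hY hz,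
    hX hz, hY hz]

theorem hasDerivAt_comp_line (hΩ : IsOpen Ω) (hz : z ∈ Ω) (v : V) (hg : ContDiffOn ℝ ∞ g Ω) :
    HasDerivAt (fun t : ℝ => g (z + t • v)) (fderiv ℝ g z v) 0 :=
  (differentiableAt_of_contDiffOn hΩ hg hz).hasFDerivAt.hasLineDerivAt v

end Calculus

/-! ### The horizontal distribution of a homogeneous spray -/

section Spray

variable {E : Type*} [NormedAddCommGroup E] [NormedSpace ℝ E]

/-- `L` is the square of a Finsler function and `S z = (y, s z)` is its geodesic spray, on an open
set `Ω` of induced coordinates `z = (x, y)`. The equation `i_S dd_J L = -dL` is recorded in its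
Euler-Lagrange form `S (∂L/∂yⁱ) = ∂L/∂xⁱ`, and the homogeneity of `L` by Euler's relation. -/
structure IsLocalSpray (L : E × E → ℝ) (s : E × E → E) (Ω : Set (E × E)) : Prop where
  isOpen : IsOpen Ω
  smooth_energy : ContDiffOn ℝ ∞ L Ω
  smooth_spray : ContDiffOn ℝ ∞ s Ω
  euler : ∀ z ∈ Ω, fderiv ℝ L z (0, z.2) = 2 * L z
  eulerLagrange : ∀ z ∈ Ω, ∀ c, fderiv ℝ (fderiv ℝ L) z (z.2, s z) (0, c) = fderiv ℝ L z (c, 0)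
  nondegenerate : ∀ z ∈ Ω, ∀ a, (∀ b, fderiv ℝ (fderiv ℝ L) z (0, a) (0, b) = 0) → a = 0

/-- The fibre component of the horizontal lift of the constant vector field `a`, that is
`-N(a)` for the nonlinear connection `N = -(1/2) ∂s/∂y`. -/
noncomputable def horCoeff (s : E × E → E) (a : E) (z : E × E) : E :=
  (1 / 2 : ℝ) • fderiv ℝ s z (0, a)

/-- The horizontal lift of the constant vector field `a`. -/
noncomputable def horLift (s : E × E → E) (a : E) (z : E × E) : E × E := (a, horCoeff s a z)

/-- The fibre component of the bracket of two horizontal lifts: `R (∂/∂xʲ, ∂/∂xᵏ)` for the basis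
vectors `a = ∂/∂xʲ`, `b = ∂/∂xᵏ`. -/
noncomputable def horCurv (s : E × E → E) (a b : E) (z : E × E) : E :=
  fderiv ℝ (horCoeff s b) z (horLift s a z) - fderiv ℝ (horCoeff s a) z (horLift s b z)

variable {L : E × E → ℝ} {s : E × E → E} {Ω : Set (E × E)} {z : E × E}

theorem fderiv_prodMk {V F G : Type*} [NormedAddCommGroup V] [NormedSpace ℝ V]
    [NormedAddCommGroup F] [NormedSpace ℝ F] [NormedAddCommGroup G] [NormedSpace ℝ G]
    {f : V → F} {g : V → G} {z : V} (hf : DifferentiableAt ℝ f z) (hg : DifferentiableAt ℝ g z)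
    (v : V) : fderiv ℝ (fun p => (f p, g p)) z v = (fderiv ℝ f z v, fderiv ℝ g z v) := by
  rw [hf.fderiv_prodMk hg]; rfl

theorem fderiv_const_prodMk {V : Type*} [NormedAddCommGroup V] [NormedSpace ℝ V] {r : V → E}
    {z : V} (hr : DifferentiableAt ℝ r z) (a : E) (v : V) :
    fderiv ℝ (fun p => (a, r p)) z v = (0, fderiv ℝ r z v) := by
  rw [fderiv_prodMk (differentiableAt_const a) hr]; simp

namespace IsLocalSpray

theorem contDiffOn_horCoeff (h : IsLocalSpray L s Ω) (a : E) :
    ContDiffOn ℝ ∞ (horCoeff s a) Ω :=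
  (contDiffOn_fderiv_apply h.isOpen h.smooth_spray contDiffOn_const).const_smul _

theorem contDiffOn_horLift (h : IsLocalSpray L s Ω) (a : E) :
    ContDiffOn ℝ ∞ (horLift s a) Ω :=
  contDiffOn_const.prodMk (h.contDiffOn_horCoeff a)

theorem fderiv_horLift (h : IsLocalSpray L s Ω) (hz : z ∈ Ω) (a : E) (v : E × E) :
    fderiv ℝ (horLift s a) z v = (0, fderiv ℝ (horCoeff s a) z v) :=
  fderiv_const_prodMk (differentiableAt_of_contDiffOn h.isOpen (h.contDiffOn_horCoeff a) hz) a v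

theorem fderiv_horCoeff (h : IsLocalSpray L s Ω) (hz : z ∈ Ω) (a : E) (v : E × E) :
    fderiv ℝ (horCoeff s a) z v = (1 / 2 : ℝ) • fderiv ℝ (fderiv ℝ s) z v (0, a) := by
  have h1 := differentiableAt_of_contDiffOn h.isOpen
    (contDiffOn_fderiv_apply (X := fun _ => (0, a)) h.isOpen h.smooth_spray contDiffOn_const) hz
  rw [← fderiv_fderiv_const h.isOpen h.smooth_spray hz]
  change fderiv ℝ (fun p => (1 / 2 : ℝ) • fderiv ℝ s p (0, a)) z v = _
  rw [fderiv_fun_const_smul h1]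
  rfl

theorem lieBracket_horLift (h : IsLocalSpray L s Ω) (hz : z ∈ Ω) (a b : E) :
    lieBracket ℝ (horLift s a) (horLift s b) z = (0, horCurv s a b z) := by
  rw [VectorField.lieBracket, h.fderiv_horLift hz, h.fderiv_horLift hz]
  simp [horCurv]

theorem contDiffOn_horCurv (h : IsLocalSpray L s Ω) (a b : E) :
    ContDiffOn ℝ ∞ (horCurv s a b) Ω :=
  (contDiffOn_fderiv_apply h.isOpen (h.contDiffOn_horCoeff b) (h.contDiffOn_horLift a)).sub
    (contDiffOn_fderiv_apply h.isOpen (h.contDiffOn_horCoeff a) (h.contDiffOn_horLift b))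

theorem horCurv_swap (a b : E) : horCurv s a b z = -horCurv s b a z := by
  simp [horCurv]

theorem fderiv_euler (h : IsLocalSpray L s Ω) (hz : z ∈ Ω) (v : E × E) :
    fderiv ℝ (fderiv ℝ L) z v (0, z.2) + fderiv ℝ L z (0, v.2) = 2 * fderiv ℝ L z v := by
  have h2 : ContDiffOn ℝ ∞ (fun p : E × E => ((0 : E), p.2)) Ω :=
    contDiffOn_const.prodMk contDiffOn_snd
  have h1 := fderiv_fderiv_apply h.isOpen h.smooth_energy h2 hz v
  rw [fderiv_eq_of_eqOn (g' := fun p => 2 * L p) h.isOpen (fun p hp => h.euler p hp) hz,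
    fderiv_const_mul (differentiableAt_of_contDiffOn h.isOpen h.smooth_energy hz),
    fderiv_const_prodMk differentiableAt_snd] at h1
  simpa [fderiv_snd] using h1.symm

/-- `y` represents half the fibre derivative of `L` in the metric `g`. -/
theorem hessian_snd (h : IsLocalSpray L s Ω) (hz : z ∈ Ω) (a : E) :
    fderiv ℝ (fderiv ℝ L) z (0, a) (0, z.2) = fderiv ℝ L z (0, a) := by
  have := h.fderiv_euler hz (0, a)
  simp only at this
  linarith

theorem contDiffOn_sprayField (h : IsLocalSpray L s Ω) :
    ContDiffOn ℝ ∞ (fun p : E × E => (p.2, s p)) Ω :=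
  contDiffOn_snd.prodMk h.smooth_spray

theorem fderiv_sprayField (h : IsLocalSpray L s Ω) (hz : z ∈ Ω) (v : E × E) :
    fderiv ℝ (fun p : E × E => (p.2, s p)) z v = (v.2, fderiv ℝ s z v) := by
  rw [fderiv_prodMk differentiableAt_snd
    (differentiableAt_of_contDiffOn h.isOpen h.smooth_spray hz)]
  simp [fderiv_snd]

/-- The energy is constant along the geodesic flow: `S L = 0`. -/
theorem energy_spray (h : IsLocalSpray L s Ω) (hz : z ∈ Ω) : fderiv ℝ L z (z.2, s z) = 0 := by
  have h1 := h.fderiv_euler hz (z.2, s z)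
  rw [h.eulerLagrange z hz] at h1
  have h2 : fderiv ℝ L z (z.2, s z) = fderiv ℝ L z (z.2, 0) + fderiv ℝ L z (0, s z) := by
    rw [← map_add]; simp
  simp only at h1
  linarith

/-- The energy is constant along horizontal curves: `d_h L = 0`. -/
theorem energy_horLift (h : IsLocalSpray L s Ω) (hz : z ∈ Ω) (a : E) :
    fderiv ℝ L z (horLift s a z) = 0 := by
  have h1 := fderiv_fderiv_apply h.isOpen h.smooth_energy h.contDiffOn_sprayField hz (0, a)
  rw [fderiv_eq_of_eqOn (g' := fun _ => (0 : ℝ)) h.isOpen (fun p hp => h.energy_spray hp) hz,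
    fderiv_fderiv_comm h.isOpen h.smooth_energy hz, h.eulerLagrange z hz,
    h.fderiv_sprayField hz] at h1
  have h2 : (2 : ℝ) • horLift s a z = (a, 0) + (a, fderiv ℝ s z (0, a)) := by
    ext <;> simp [horLift, horCoeff, two_smul, ← add_smul]
    norm_num
  have h3 : 2 * fderiv ℝ L z (horLift s a z) = 0 := by
    rw [← smul_eq_mul, ← map_smul, h2, map_add]
    simpa using h1.symm
  linarith

/-- The curvature is tangent to the level sets of the energy: `d_R L = 0`. -/
theorem energy_horCurv (h : IsLocalSpray L s Ω) (hz : z ∈ Ω) (a b : E) :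
    fderiv ℝ L z (0, horCurv s a b z) = 0 := by
  rw [← h.lieBracket_horLift hz, fderiv_lieBracket h.isOpen h.smooth_energy
    (h.contDiffOn_horLift a) (h.contDiffOn_horLift b) hz,
    fderiv_eq_of_eqOn (g' := fun _ => (0 : ℝ)) h.isOpen (fun p hp => h.energy_horLift hp b) hz,
    fderiv_eq_of_eqOn (g' := fun _ => (0 : ℝ)) h.isOpen (fun p hp => h.energy_horLift hp a) hz]
  simp

theorem contDiffOn_liouville : ContDiffOn ℝ ∞ (fun p : E × E => ((0 : E), p.2)) Ω :=
  contDiffOn_const.prodMk contDiffOn_snd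

theorem fderiv_liouville (v : E × E) :
    fderiv ℝ (fun p : E × E => ((0 : E), p.2)) z v = (0, v.2) := by
  rw [fderiv_const_prodMk differentiableAt_snd]; simp [fderiv_snd]

/-- The spray coefficients are homogeneous of degree two. -/
theorem spray_homogeneous (h : IsLocalSpray L s Ω) (hz : z ∈ Ω) :
    fderiv ℝ s z (0, z.2) = (2 : ℝ) • s z := by
  rw [← sub_eq_zero]
  refine h.nondegenerate z hz _ fun c => ?_
  -- The commutator of the Liouville field `C` and `S` applied to `∂L/∂y`.
  have hm : ContDiffOn ℝ ∞ (fun p => fderiv ℝ L p (0, c)) Ω :=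
    contDiffOn_fderiv_apply (X := fun _ => (0, c)) h.isOpen h.smooth_energy contDiffOn_const
  have h1 := fderiv_lieBracket h.isOpen hm (contDiffOn_liouville (E := E))
    h.contDiffOn_sprayField hz
  have e1 : Set.EqOn (fun p => fderiv ℝ (fun p => fderiv ℝ L p (0, c)) p (p.2, s p))
      (fun p => fderiv ℝ L p (c, 0)) Ω := fun p hp => by
    simp only [fderiv_fderiv_const h.isOpen h.smooth_energy hp, h.eulerLagrange p hp]
  have e2 : Set.EqOn (fun p => fderiv ℝ (fun p => fderiv ℝ L p (0, c)) p (0, p.2))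
      (fun p => fderiv ℝ L p (0, c)) Ω := fun p hp => by
    simp only [fderiv_fderiv_const h.isOpen h.smooth_energy hp]
    rw [fderiv_fderiv_comm h.isOpen h.smooth_energy hp, h.hessian_snd hp]
  rw [fderiv_eq_of_eqOn h.isOpen e1 hz, fderiv_eq_of_eqOn h.isOpen e2 hz] at h1
  simp only [fderiv_fderiv_const h.isOpen h.smooth_energy hz] at h1
  rw [h.eulerLagrange z hz, VectorField.lieBracket, h.fderiv_sprayField hz, fderiv_liouville] at h1
  have h2 := h.fderiv_euler hz (c, 0)
  rw [fderiv_fderiv_comm h.isOpen h.smooth_energy hz] at h2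
  have h3 := h.eulerLagrange z hz c
  have e3 : ((0 : E), fderiv ℝ s z (0, z.2) - (2 : ℝ) • s z) =
      (((z.2, fderiv ℝ s z (0, z.2)) : E × E) - (0, s z)) - (z.2, s z) := by
    ext <;> simp [two_smul, sub_sub]
  rw [e3, map_sub, sub_apply, h1, h3]
  have h0 : fderiv ℝ L z ((0 : E), (0 : E)) = 0 := map_zero _
  simp only [h0] at h2
  linarith

/-- The connection coefficients are homogeneous of degree one. -/
theorem horCoeff_homogeneous (h : IsLocalSpray L s Ω) (hz : z ∈ Ω) (a : E) :
    fderiv ℝ (horCoeff s a) z (0, z.2) = horCoeff s a z := by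
  have h1 := fderiv_fderiv_apply h.isOpen h.smooth_spray (contDiffOn_liouville (E := E)) hz (0, a)
  rw [fderiv_eq_of_eqOn (g' := fun p => (2 : ℝ) • s p) h.isOpen
    (fun p hp => h.spray_homogeneous hp) hz,
    fderiv_fun_const_smul (differentiableAt_of_contDiffOn h.isOpen h.smooth_spray hz),
    fderiv_liouville] at h1
  rw [h.fderiv_horCoeff hz, fderiv_fderiv_comm h.isOpen h.smooth_spray hz, horCoeff]
  congr 1
  simp only [two_smul, add_apply] at h1
  exact (add_right_cancel h1).symm

theorem fderiv_horCoeff_vert_comm (h : IsLocalSpray L s Ω) (hz : z ∈ Ω) (a b : E) :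
    fderiv ℝ (horCoeff s a) z (0, b) = fderiv ℝ (horCoeff s b) z (0, a) := by
  rw [h.fderiv_horCoeff hz, h.fderiv_horCoeff hz, fderiv_fderiv_comm h.isOpen h.smooth_spray hz]

theorem lieBracket_vert_horLift (h : IsLocalSpray L s Ω) (hz : z ∈ Ω) (a b : E) :
    lieBracket ℝ (fun _ => ((0 : E), a)) (horLift s b) z
      = (0, fderiv ℝ (horCoeff s b) z (0, a)) := by
  rw [VectorField.lieBracket, h.fderiv_horLift hz]; simp

theorem contDiffOn_vertCurv (h : IsLocalSpray L s Ω) (a b : E) :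
    ContDiffOn ℝ ∞ (fun p => ((0 : E), horCurv s a b p)) Ω :=
  contDiffOn_const.prodMk (h.contDiffOn_horCurv a b)

theorem fderiv_vertCurv (h : IsLocalSpray L s Ω) (hz : z ∈ Ω) (a b : E) (v : E × E) :
    fderiv ℝ (fun p => ((0 : E), horCurv s a b p)) z v = (0, fderiv ℝ (horCurv s a b) z v) :=
  fderiv_const_prodMk (differentiableAt_of_contDiffOn h.isOpen (h.contDiffOn_horCurv a b) hz) _ _

theorem eqOn_lieBracket_horLift (h : IsLocalSpray L s Ω) (a b : E) :
    Set.EqOn (lieBracket ℝ (horLift s a) (horLift s b)) (fun p => ((0 : E), horCurv s a b p)) Ω :=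
  fun _ hp => h.lieBracket_horLift hp a b

/-- The vertical Bianchi identity `[J, R] = 0`. -/
theorem bianchi_vert (h : IsLocalSpray L s Ω) (hz : z ∈ Ω) (a b c : E) :
    fderiv ℝ (horCurv s b c) z (0, a) + fderiv ℝ (horCurv s c a) z (0, b)
      + fderiv ℝ (horCurv s a b) z (0, c) = 0 := by
  have key (a b c : E) : ((0 : E), fderiv ℝ (horCurv s b c) z (0, a)) =
      lieBracket ℝ (lieBracket ℝ (fun _ => ((0 : E), a)) (horLift s b)) (horLift s c) z
      - lieBracket ℝ (lieBracket ℝ (fun _ => ((0 : E), a)) (horLift s c)) (horLift s b) z := by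
    have h1 := lieBracket_jacobi (X := fun _ => ((0 : E), a)) h.isOpen contDiffOn_const
      (h.contDiffOn_horLift b) (h.contDiffOn_horLift c) hz
    rw [lieBracket_eq_of_eqOn h.isOpen (fun _ _ => rfl) (h.eqOn_lieBracket_horLift b c) hz] at h1
    rw [VectorField.lieBracket, h.fderiv_vertCurv hz,
      VectorField.lieBracket_swap (W := lieBracket ℝ _ (horLift s c))] at h1
    simpa [sub_eq_add_neg] using h1
  have sym (a b : E) : Set.EqOn (lieBracket ℝ (fun _ => ((0 : E), a)) (horLift s b))
      (lieBracket ℝ (fun _ => ((0 : E), b)) (horLift s a)) Ω := fun p hp => by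
    rw [h.lieBracket_vert_horLift hp, h.lieBracket_vert_horLift hp,
      h.fderiv_horCoeff_vert_comm hp]
  have sym' (a b c : E) := lieBracket_eq_of_eqOn h.isOpen (sym a b)
    (fun _ _ => rfl : Set.EqOn (horLift s c) (horLift s c) Ω) hz
  have hsum : ((0 : E), fderiv ℝ (horCurv s b c) z (0, a)) + (0, fderiv ℝ (horCurv s c a) z (0, b))
      + (0, fderiv ℝ (horCurv s a b) z (0, c)) = 0 := by
    rw [key a b c, key b c a, key c a b, sym' b a c, sym' c a b, sym' c b a]
    abel
  simpa using congrArg Prod.snd hsum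

/-- The horizontal Bianchi identity `[h, R] = 0`. -/
theorem bianchi_hor (h : IsLocalSpray L s Ω) (hz : z ∈ Ω) (a b c : E) :
    (fderiv ℝ (horCurv s b c) z (horLift s a z)
        - fderiv ℝ (horCoeff s a) z (0, horCurv s b c z))
      + (fderiv ℝ (horCurv s c a) z (horLift s b z)
        - fderiv ℝ (horCoeff s b) z (0, horCurv s c a z))
      + (fderiv ℝ (horCurv s a b) z (horLift s c z)
        - fderiv ℝ (horCoeff s c) z (0, horCurv s a b z)) = 0 := by
  have key (a b c : E) : lieBracket ℝ (horLift s a) (lieBracket ℝ (horLift s b) (horLift s c)) z =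
      (0, fderiv ℝ (horCurv s b c) z (horLift s a z)
        - fderiv ℝ (horCoeff s a) z (0, horCurv s b c z)) := by
    rw [lieBracket_eq_of_eqOn h.isOpen (fun _ _ => rfl) (h.eqOn_lieBracket_horLift b c) hz,
      VectorField.lieBracket, h.fderiv_vertCurv hz, h.fderiv_horLift hz]
    simp
  have h1 := lieBracket_jacobi h.isOpen (h.contDiffOn_horLift a)
    (h.contDiffOn_horLift b) (h.contDiffOn_horLift c) hz
  rw [VectorField.lieBracket_swap (V := lieBracket ℝ _ _), key, key, key,
    show horCurv s a c = fun p => -horCurv s c a p from funext fun _ => horCurv_swap a c,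
    fderiv_fun_neg] at h1
  have h0 : ((0 : E), -horCurv s c a z) = -(0, horCurv s c a z) := by simp
  have h2 := congrArg Prod.snd h1
  simp only [Prod.snd_add, Prod.snd_neg, neg_apply, h0, map_neg] at h2
  rw [h2]; abel

/-- The curvature is homogeneous of degree one. -/
theorem horCurv_homogeneous (h : IsLocalSpray L s Ω) (hz : z ∈ Ω) (a b : E) :
    fderiv ℝ (horCurv s a b) z (0, z.2) = horCurv s a b z := by
  have zero (a : E) : Set.EqOn (lieBracket ℝ (fun p : E × E => ((0 : E), p.2)) (horLift s a))
      (fun _ => 0) Ω := fun p hp => by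
    rw [VectorField.lieBracket, h.fderiv_horLift hp, fderiv_liouville, h.horCoeff_homogeneous hp]
    simp [horLift]
  have h1 := lieBracket_jacobi (X := fun p : E × E => ((0 : E), p.2)) h.isOpen
    contDiffOn_liouville (h.contDiffOn_horLift a) (h.contDiffOn_horLift b) hz
  rw [lieBracket_eq_of_eqOn h.isOpen (fun _ _ => rfl) (h.eqOn_lieBracket_horLift a b) hz,
    lieBracket_eq_of_eqOn h.isOpen (zero a) (fun _ _ => rfl) hz,
    lieBracket_eq_of_eqOn h.isOpen (fun _ _ => rfl) (zero b) hz, VectorField.lieBracket,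
    h.fderiv_vertCurv hz, fderiv_liouville] at h1
  have h2 := congrArg Prod.snd h1
  simp only [VectorField.lieBracket] at h2
  simpa [sub_eq_zero] using h2

end IsLocalSpray

end Spray

/-! ### Curvature tensors of the form `ξ ∧ J` -/

section Wedge

variable {E : Type*} [NormedAddCommGroup E] [NormedSpace ℝ E]

/-- The covector `y_i = g_{ij} yʲ = (1/2) ∂L/∂yⁱ`. -/
noncomputable def flat (L : E × E → ℝ) (a : E) (z : E × E) : ℝ := (1 / 2) * fderiv ℝ L z (0, a)

/-- The bilinear form `(1/2) ∂²L/∂yⁱ∂yʲ`; for `L = f²` it is the metric tensor `metric f`. -/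
noncomputable def hess (L : E × E → ℝ) (z : E × E) (a b : E) : ℝ :=
  (1 / 2) * fderiv ℝ (fderiv ℝ L) z (0, a) (0, b)

theorem hess_add_left (L : E × E → ℝ) (z : E × E) (a b c : E) :
    hess L z (a + b) c = hess L z a c + hess L z b c := by
  have : ((0 : E), a + b) = (0, a) + (0, b) := by simp
  simp only [hess, this, map_add, add_apply]; ring

theorem hess_smul_left (L : E × E → ℝ) (z : E × E) (t : ℝ) (a c : E) :
    hess L z (t • a) c = t * hess L z a c := by
  have : ((0 : E), t • a) = t • (0, a) := by simp
  simp only [hess, this, map_smul, smul_apply, smul_eq_mul]; ring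

theorem hess_add_right (L : E × E → ℝ) (z : E × E) (a b c : E) :
    hess L z a (b + c) = hess L z a b + hess L z a c := by
  have : ((0 : E), b + c) = (0, b) + (0, c) := by simp
  simp only [hess, this, map_add]; ring

theorem hess_smul_right (L : E × E → ℝ) (z : E × E) (t : ℝ) (a c : E) :
    hess L z a (t • c) = t * hess L z a c := by
  have : ((0 : E), t • c) = t • (0, c) := by simp
  simp only [hess, this, map_smul, smul_eq_mul]; ring

theorem hess_sub_right (L : E × E → ℝ) (z : E × E) (a b c : E) :
    hess L z a (b - c) = hess L z a b - hess L z a c := by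
  rw [sub_eq_add_neg, ← neg_one_smul ℝ c, hess_add_right, hess_smul_right]; ring

theorem hess_neg_right (L : E × E → ℝ) (z : E × E) (a b : E) :
    hess L z a (-b) = -hess L z a b := by
  rw [← neg_one_smul ℝ b, hess_smul_right]; ring

theorem flat_add (L : E × E → ℝ) (z : E × E) (a b : E) :
    flat L (a + b) z = flat L a z + flat L b z := by
  have : ((0 : E), a + b) = (0, a) + (0, b) := by simp
  simp only [flat, this, map_add]; ring

theorem flat_smul (L : E × E → ℝ) (z : E × E) (t : ℝ) (a : E) :
    flat L (t • a) z = t * flat L a z := by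
  have : ((0 : E), t • a) = t • (0, a) := by simp
  simp only [flat, this, map_smul, smul_eq_mul]; ring

theorem flat_sub (L : E × E → ℝ) (z : E × E) (a b : E) :
    flat L (a - b) z = flat L a z - flat L b z := by
  rw [sub_eq_add_neg, ← neg_one_smul ℝ b, flat_add, flat_smul]; ring

variable {L : E × E → ℝ} {s : E × E → E} {Ω : Set (E × E)} {z : E × E}

/-- The denominator of the flag curvature is positive: the Cauchy-Schwarz inequality for `g`. -/
theorem hess_gram_pos (hpos : ∀ a, a ≠ 0 → 0 < hess L z a a)
    (hsymm : ∀ a b, hess L z a b = hess L z b a) {y X : E} (hX : LinearIndependent ℝ ![y, X]) :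
    0 < hess L z y y * hess L z X X - hess L z y X ^ 2 := by
  have hy : y ≠ 0 := by simpa using hX.ne_zero 0
  have hyy := hpos y hy
  have hw : hess L z y y • X + (-hess L z y X) • y ≠ 0 := fun h0 => by
    have := (LinearIndependent.pair_iff.mp hX) (-hess L z y X) (hess L z y y)
      (by rw [add_comm]; exact h0)
    exact hyy.ne' this.2
  have h1 := hpos _ hw
  simp only [hess_add_left, hess_add_right, hess_smul_left, hess_smul_right, hsymm X y] at h1
  have h2 : 0 < hess L z y y * (hess L z y y * hess L z X X - hess L z y X ^ 2) := by
    nlinarith [h1]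
  exact pos_of_mul_pos_right h2 hyy.le

theorem exists_notMem_span_pair (hdim : 2 < Module.finrank ℝ E) (a b : E) :
    ∃ c, c ∉ Submodule.span ℝ {a, b} := by
  by_contra! hcon
  have htop : Submodule.span ℝ {a, b} = ⊤ := Submodule.eq_top_iff'.mpr hcon
  classical
  have h1 := finrank_span_finset_le_card (R := ℝ) ({a, b} : Finset E)
  rw [Set.finrank, Finset.coe_pair, htop, finrank_top] at h1
  exact absurd (h1.trans Finset.card_le_two) (by omega)

/-- A cyclic sum `α ∧ ℓ ∧ Id` vanishes in dimension at least three only if `α ∧ ℓ = 0`. -/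
theorem wedge_eq_zero_of_cyclic (hdim : 2 < Module.finrank ℝ E) (α l : E → ℝ)
    (H : ∀ a b c, α a • (l b • c - l c • b) + α b • (l c • a - l a • c)
      + α c • (l a • b - l b • a) = 0) (a b : E) : α a * l b = α b * l a := by
  obtain ⟨c, hc⟩ := exists_notMem_span_pair hdim a b
  by_contra hne
  have hk : α a * l b - α b * l a ≠ 0 := sub_ne_zero.mpr hne
  refine hc ((Submodule.smul_mem_iff _ hk).mp ?_)
  have h1 : (α a * l b - α b * l a) • c =
      (α c * l b - α b * l c) • a + (α a * l c - α c * l a) • b := by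
    rw [← sub_eq_zero, ← H a b c]; module
  rw [h1]
  exact Submodule.mem_span_pair.mpr ⟨_, _, rfl⟩

namespace IsLocalSpray

theorem hess_comm (h : IsLocalSpray L s Ω) (hz : z ∈ Ω) (a b : E) :
    hess L z a b = hess L z b a := by
  rw [hess, hess, fderiv_fderiv_comm h.isOpen h.smooth_energy hz]

theorem hess_snd_right (h : IsLocalSpray L s Ω) (hz : z ∈ Ω) (a : E) :
    hess L z a z.2 = flat L a z := by
  rw [hess, flat, h.hessian_snd hz]

theorem hess_snd_left (h : IsLocalSpray L s Ω) (hz : z ∈ Ω) (a : E) :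
    hess L z z.2 a = flat L a z := by
  rw [h.hess_comm hz, h.hess_snd_right hz]

theorem flat_snd (h : IsLocalSpray L s Ω) (hz : z ∈ Ω) : flat L z.2 z = L z := by
  rw [flat, h.euler z hz]; ring

theorem eq_zero_of_hess (h : IsLocalSpray L s Ω) (hz : z ∈ Ω) {a : E}
    (ha : ∀ b, hess L z b a = 0) : a = 0 :=
  h.nondegenerate z hz a fun b => by
    have := ha b
    rw [h.hess_comm hz, hess] at this
    linarith

theorem contDiffOn_flat (h : IsLocalSpray L s Ω) (a : E) : ContDiffOn ℝ ∞ (flat L a) Ω :=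
  contDiffOn_const.mul
    (contDiffOn_fderiv_apply (X := fun _ => (0, a)) h.isOpen h.smooth_energy contDiffOn_const)

theorem fderiv_flat (h : IsLocalSpray L s Ω) (hz : z ∈ Ω) (a : E) (v : E × E) :
    fderiv ℝ (flat L a) z v = (1 / 2) * fderiv ℝ (fderiv ℝ L) z v (0, a) := by
  have h1 := differentiableAt_of_contDiffOn h.isOpen
    (contDiffOn_fderiv_apply (X := fun _ => (0, a)) h.isOpen h.smooth_energy contDiffOn_const) hz
  rw [← fderiv_fderiv_const h.isOpen h.smooth_energy hz]
  change fderiv ℝ (fun p => (1 / 2 : ℝ) * fderiv ℝ L p (0, a)) z v = _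
  rw [fderiv_const_mul h1]
  rfl

theorem horLift_add (a b : E) : horLift s (a + b) z = horLift s a z + horLift s b z := by
  have : ((0 : E), a + b) = (0, a) + (0, b) := by simp
  rw [horLift, horCoeff, this, map_add, smul_add]
  rfl

theorem horLift_smul (t : ℝ) (a : E) : horLift s (t • a) z = t • horLift s a z := by
  have : ((0 : E), t • a) = t • (0, a) := by simp
  rw [horLift, horCoeff, this, map_smul, smul_comm]
  rfl

theorem horCurv_add_left (h : IsLocalSpray L s Ω) (hz : z ∈ Ω) (a b c : E) :
    horCurv s (a + b) c z = horCurv s a c z + horCurv s b c z := by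
  have : ((0 : E), a + b) = (0, a) + (0, b) := by simp
  simp only [horCurv, h.fderiv_horCoeff hz, horLift_add, this, map_add, add_apply, smul_add]
  abel

theorem horCurv_smul_left (h : IsLocalSpray L s Ω) (hz : z ∈ Ω) (t : ℝ) (a c : E) :
    horCurv s (t • a) c z = t • horCurv s a c z := by
  have : ((0 : E), t • a) = t • (0, a) := by simp
  simp only [horCurv, h.fderiv_horCoeff hz, horLift_smul, this, map_smul, smul_apply]
  module

theorem horCurv_add_right (h : IsLocalSpray L s Ω) (hz : z ∈ Ω) (a b c : E) :
    horCurv s a (b + c) z = horCurv s a b z + horCurv s a c z := by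
  rw [horCurv_swap, h.horCurv_add_left hz, horCurv_swap b, horCurv_swap c]; abel

/-- The first Bianchi identity for the curvature with lowered index. -/
theorem hess_horCurv_cyclic (h : IsLocalSpray L s Ω) (hz : z ∈ Ω) (a b c : E) :
    hess L z a (horCurv s b c z) + hess L z b (horCurv s c a z)
      + hess L z c (horCurv s a b z) = 0 := by
  -- The fibre derivative of `d_R L = 0`, summed cyclically.
  have key (a b c : E) : 2 * hess L z a (horCurv s b c z)
      = -fderiv ℝ L z (0, fderiv ℝ (horCurv s b c) z (0, a)) := by
    have h1 := fderiv_fderiv_apply h.isOpen h.smooth_energy (h.contDiffOn_vertCurv b c) hz (0, a)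
    rw [fderiv_eq_of_eqOn (g' := fun _ => (0 : ℝ)) h.isOpen
      (fun p hp => h.energy_horCurv hp b c) hz, h.fderiv_vertCurv hz] at h1
    simp only [fderiv_fun_const, Pi.zero_apply, zero_apply] at h1
    rw [hess]; linarith
  have h2 := congrArg (fun v => fderiv ℝ L z ((0 : E), v)) (h.bianchi_vert hz a b c)
  have h3 (u v : E) : fderiv ℝ L z (0, u + v) = fderiv ℝ L z (0, u) + fderiv ℝ L z (0, v) := by
    rw [← map_add]; simp
  have h0 : fderiv ℝ L z ((0 : E), (0 : E)) = 0 := map_zero _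
  simp only [h3, h0] at h2
  linarith [key a b c, key b c a, key c a b]

theorem flat_horCurv (h : IsLocalSpray L s Ω) (hz : z ∈ Ω) (a b : E) :
    flat L (horCurv s a b z) z = 0 := by
  rw [flat, h.energy_horCurv hz, mul_zero]

/-- The Jacobi endomorphism `R (y, ·)` is self-adjoint. -/
theorem hess_jacobi_comm (h : IsLocalSpray L s Ω) (hz : z ∈ Ω) (a b : E) :
    hess L z a (horCurv s z.2 b z) = hess L z b (horCurv s z.2 a z) := by
  have h1 := h.hess_horCurv_cyclic hz z.2 b a
  rw [h.hess_snd_left hz, h.flat_horCurv hz, horCurv_swap a, hess_neg_right] at h1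
  linarith

/-- Constant flag curvature determines the Jacobi endomorphism, by polarization. -/
theorem jacobi_eq_of_flag (h : IsLocalSpray L s Ω) (hz : z ∈ Ω)
    (hpos : ∀ a, a ≠ 0 → 0 < hess L z a a) (hy : z.2 ≠ 0) {κ : ℝ}
    (hflag : ∀ X, LinearIndependent ℝ ![z.2, X] →
      hess L z X (horCurv s z.2 X z) /
        (hess L z z.2 z.2 * hess L z X X - hess L z z.2 X ^ 2) = κ) (X : E) :
    horCurv s z.2 X z = κ • (L z • X - flat L X z • z.2) := by
  have hdiag (X : E) : hess L z X (horCurv s z.2 X z) =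
      κ * (L z * hess L z X X - flat L X z ^ 2) := by
    by_cases hX : LinearIndependent ℝ ![z.2, X]
    · have h1 := hess_gram_pos hpos (h.hess_comm hz) hX
      have h2 := (div_eq_iff h1.ne').mp (hflag X hX)
      rwa [h.hess_snd_left hz, h.hess_snd_left hz, h.flat_snd hz] at h2
    · obtain ⟨t, rfl⟩ : ∃ t : ℝ, t • z.2 = X := by
        simpa [LinearIndependent.pair_iff' hy] using hX
      rw [hess_smul_left, h.hess_snd_left hz, h.flat_horCurv hz, hess_smul_left,
        hess_smul_right, h.hess_snd_left hz, h.flat_snd hz, flat_smul, h.flat_snd hz]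
      ring
  rw [← sub_eq_zero]
  refine h.eq_zero_of_hess hz fun b => ?_
  have h1 := hdiag (X + b)
  rw [h.horCurv_add_right hz] at h1
  simp only [hess_add_left, hess_add_right, flat_add] at h1
  rw [hess_sub_right, hess_smul_right, hess_sub_right, hess_smul_right, hess_smul_right,
    h.hess_snd_right hz]
  have h2 := h.hess_jacobi_comm hz X b
  have h3 := h.hess_comm hz X b
  rw [h2, h3] at h1
  linarith [hdiag X, hdiag b]

/-- If the flag curvature is a constant `κ`, then `R = κ d_J L / 2 ∧ J`: by the vertical Bianchi
identity and homogeneity, `3 R` is the antisymmetrized fibre derivative of the Jacobi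
endomorphism. -/
theorem horCurv_eq_of_jacobi (h : IsLocalSpray L s Ω) {κ : ℝ}
    (hjac : ∀ p ∈ Ω, ∀ X, horCurv s p.2 X p = κ • (L p • X - flat L X p • p.2)) (hz : z ∈ Ω)
    (a b : E) : horCurv s a b z = κ • (flat L a z • b - flat L b z • a) := by
  have key (a X : E) : fderiv ℝ (horCurv s z.2 X) z (0, a) + horCurv s a X z =
      κ • ((2 * flat L a z) • X - hess L z a X • z.2 - flat L X z • a) := by
    -- Differentiate `hjac` along the line `t ↦ z + t (0, a)`, where `y` itself varies.
    have hmem : ∀ᶠ t : ℝ in 𝓝 0, z + t • ((0 : E), a) ∈ Ω := by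
      have hc : ContinuousAt (fun t : ℝ => z + t • ((0 : E), a)) 0 := by fun_prop
      exact hc.eventually_mem (by simpa using h.isOpen.mem_nhds hz)
    have hL := (hasDerivAt_comp_line h.isOpen hz (0, a) (h.contDiffOn_horCurv z.2 X)).add
      ((hasDerivAt_id (0 : ℝ)).smul
        (hasDerivAt_comp_line h.isOpen hz (0, a) (h.contDiffOn_horCurv a X)))
    have hR := (((hasDerivAt_comp_line h.isOpen hz (0, a) h.smooth_energy).smul_const X).sub
      ((hasDerivAt_comp_line h.isOpen hz (0, a) (h.contDiffOn_flat X)).smul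
        (((hasDerivAt_id (0 : ℝ)).smul_const a).const_add z.2))).const_smul κ
    have heq := hL.unique (hR.congr_of_eventuallyEq (by
      filter_upwards [hmem] with t ht
      have h1 := hjac _ ht X
      have h2 : (z + t • ((0 : E), a)).2 = z.2 + t • a := by simp
      rw [h2, h.horCurv_add_left ht, h.horCurv_smul_left ht] at h1
      simpa using h1))
    simp only [id, zero_smul, one_smul, zero_add, add_zero] at heq
    have hLa : fderiv ℝ L z (0, a) = 2 * flat L a z := by rw [flat]; ring
    rw [heq, h.fderiv_flat hz, hess, hLa]
    module
  have h1 := h.bianchi_vert hz z.2 a b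
  rw [h.horCurv_homogeneous hz,
    show horCurv s b z.2 = fun p => -horCurv s z.2 b p from funext fun _ => horCurv_swap b z.2,
    fderiv_fun_neg, neg_apply, eq_sub_of_add_eq (key a b), eq_sub_of_add_eq (key b a),
    horCurv_swap b a, h.hess_comm hz b a] at h1
  have h2 : (3 : ℝ) • (horCurv s a b z - κ • (flat L a z • b - flat L b z • a)) = 0 := by
    rw [← h1]; module
  have h3 := (smul_eq_zero.mp h2).resolve_left (by norm_num)
  exact sub_eq_zero.mp h3

/-! ### Schur's lemma -/

/-- If `R = ξ ∧ J` then `ξ` is a multiple of `d_J L / 2`. -/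
theorem form_eq_of_wedge (h : IsLocalSpray L s Ω) (hz : z ∈ Ω) (hL : L z ≠ 0) {ξ : E → ℝ}
    (hw : ∀ a b, horCurv s a b z = ξ a • b - ξ b • a) (a : E) :
    ξ a = ξ z.2 / L z * flat L a z := by
  have h1 := h.flat_horCurv hz a z.2
  rw [hw, flat_sub, flat_smul, flat_smul, h.flat_snd hz] at h1
  field_simp
  linarith

/-- `δ_b (y_♭ a)` is symmetric in `a` and `b`: the fibre derivative of `d_h L = 0`, as the fibre
derivatives of the connection coefficients are symmetric. -/
theorem fderiv_flat_horLift_comm (h : IsLocalSpray L s Ω) (hz : z ∈ Ω) (a b : E) :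
    fderiv ℝ (flat L a) z (horLift s b z) = fderiv ℝ (flat L b) z (horLift s a z) := by
  have key (a b : E) : fderiv ℝ (flat L a) z (horLift s b z) =
      -(1 / 2) * fderiv ℝ L z (0, fderiv ℝ (horCoeff s b) z (0, a)) := by
    have h1 := fderiv_fderiv_apply h.isOpen h.smooth_energy (h.contDiffOn_horLift b) hz (0, a)
    rw [fderiv_eq_of_eqOn (g' := fun _ => (0 : ℝ)) h.isOpen
      (fun p hp => h.energy_horLift hp b) hz, h.fderiv_horLift hz,
      fderiv_fderiv_comm h.isOpen h.smooth_energy hz] at h1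
    simp only [fderiv_fun_const, Pi.zero_apply, zero_apply] at h1
    rw [h.fderiv_flat hz]; linarith
  rw [key, key, h.fderiv_horCoeff_vert_comm hz]

theorem fderiv_horCurv_of_wedge (h : IsLocalSpray L s Ω) {ρ : E × E → ℝ}
    (hρ : ContDiffOn ℝ ∞ ρ Ω)
    (hw : ∀ p ∈ Ω, ∀ a b, horCurv s a b p = ρ p • (flat L a p • b - flat L b p • a))
    (hz : z ∈ Ω) (a b : E) (v : E × E) :
    fderiv ℝ (horCurv s a b) z v =
      fderiv ℝ ρ z v • (flat L a z • b - flat L b z • a)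
        + ρ z • (fderiv ℝ (flat L a) z v • b - fderiv ℝ (flat L b) z v • a) := by
  have ha := differentiableAt_of_contDiffOn h.isOpen (h.contDiffOn_flat a) hz
  have hb := differentiableAt_of_contDiffOn h.isOpen (h.contDiffOn_flat b) hz
  have hr := differentiableAt_of_contDiffOn h.isOpen hρ hz
  have h1 : fderiv ℝ (fun p => ρ p • (flat L a p • b - flat L b p • a)) z = _ :=
    (hr.hasFDerivAt.smul
      ((ha.hasFDerivAt.smul_const b).sub (hb.hasFDerivAt.smul_const a))).fderiv
  rw [fderiv_eq_of_eqOn h.isOpen (fun p hp => hw p hp a b) hz, h1]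
  simp [add_comm]

/-- The factor `ρ` in `R = ρ d_J L / 2 ∧ J` is constant along the fibres. -/
theorem fderiv_vert_eq_zero (h : IsLocalSpray L s Ω) (hdim : 2 < Module.finrank ℝ E)
    {ρ : E × E → ℝ} (hρ : ContDiffOn ℝ ∞ ρ Ω)
    (hw : ∀ p ∈ Ω, ∀ a b, horCurv s a b p = ρ p • (flat L a p • b - flat L b p • a))
    (hz : z ∈ Ω) (hL : L z ≠ 0) (a : E) : fderiv ℝ ρ z (0, a) = 0 := by
  have hD := h.fderiv_horCurv_of_wedge hρ hw hz
  have hv (a b : E) : fderiv ℝ (flat L a) z (0, b) = hess L z a b := by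
    rw [h.fderiv_flat hz, h.hess_comm hz, hess]
  have h1 := wedge_eq_zero_of_cyclic hdim (fun a => fderiv ℝ ρ z (0, a)) (fun a => flat L a z)
    (fun a b c => by
      have := h.bianchi_vert hz a b c
      rw [hD, hD, hD] at this
      simp only [hv, h.hess_comm hz b a, h.hess_comm hz c a, h.hess_comm hz c b] at this
      exact Eq.trans (by module) this)
  have h2 : fderiv ℝ ρ z (0, z.2) = 0 := by
    obtain ⟨c, hc⟩ := exists_notMem_span_pair hdim z.2 z.2
    have h3 := h.horCurv_homogeneous hz z.2 c
    rw [hD, hw z hz, hv, hv, h.hess_snd_right hz, h.hess_snd_right hz, add_eq_right] at h3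
    refine (smul_eq_zero.mp h3).resolve_right fun h4 => hc ?_
    rw [h.flat_snd hz, sub_eq_zero] at h4
    refine (Submodule.smul_mem_iff _ hL).mp ?_
    rw [h4]
    exact Submodule.smul_mem _ _ (Submodule.subset_span (by simp))
  have h3 := h1 a z.2
  simp only [h2, h.flat_snd hz, zero_mul] at h3
  exact (mul_eq_zero.mp h3).resolve_right hL

/-- The horizontal Bianchi identity for `R = ρ d_J L / 2 ∧ J` reduces to `d_h ρ ∧ d_J L = 0`. -/
theorem fderiv_hor_wedge (h : IsLocalSpray L s Ω) (hdim : 2 < Module.finrank ℝ E)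
    {ρ : E × E → ℝ} (hρ : ContDiffOn ℝ ∞ ρ Ω)
    (hw : ∀ p ∈ Ω, ∀ a b, horCurv s a b p = ρ p • (flat L a p • b - flat L b p • a))
    (hz : z ∈ Ω) (a b : E) :
    fderiv ℝ ρ z (horLift s a z) * flat L b z = fderiv ℝ ρ z (horLift s b z) * flat L a z := by
  have hD := h.fderiv_horCurv_of_wedge hρ hw hz
  refine wedge_eq_zero_of_cyclic hdim (fun a => fderiv ℝ ρ z (horLift s a z))
    (fun a => flat L a z) (fun a b c => ?_) a b
  have h1 := h.bianchi_hor hz a b c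
  have hvert (d a b : E) : fderiv ℝ (horCoeff s d) z (0, horCurv s a b z) =
      ρ z • (flat L a z • fderiv ℝ (horCoeff s d) z (0, b)
        - flat L b z • fderiv ℝ (horCoeff s d) z (0, a)) := by
    have : ((0 : E), horCurv s a b z) = ρ z • (flat L a z • (0, b) - flat L b z • (0, a)) := by
      rw [hw z hz]; simp
    rw [this, map_smul, map_sub, map_smul, map_smul]
  rw [hD, hD, hD, hvert, hvert, hvert, h.fderiv_flat_horLift_comm hz b a,
    h.fderiv_flat_horLift_comm hz c a,
    h.fderiv_flat_horLift_comm hz c b, h.fderiv_horCoeff_vert_comm hz b a,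
    h.fderiv_horCoeff_vert_comm hz c a, h.fderiv_horCoeff_vert_comm hz c b] at h1
  exact Eq.trans (by module) h1

/-- Schur's lemma: in dimension at least three, the factor `ρ` in `R = ρ d_J L / 2 ∧ J` is locally
constant. -/
theorem fderiv_eq_zero_of_wedge (h : IsLocalSpray L s Ω) (hdim : 2 < Module.finrank ℝ E)
    {ρ : E × E → ℝ} (hρ : ContDiffOn ℝ ∞ ρ Ω)
    (hw : ∀ p ∈ Ω, ∀ a b, horCurv s a b p = ρ p • (flat L a p • b - flat L b p • a))
    (hL : ∀ p ∈ Ω, L p ≠ 0) (hz : z ∈ Ω) : fderiv ℝ ρ z = 0 := by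
  have hvert : ∀ p ∈ Ω, ∀ a, fderiv ℝ ρ p (0, a) = 0 := fun p hp =>
    h.fderiv_vert_eq_zero hdim hρ hw hp (hL p hp)
  have hhor : ∀ p ∈ Ω, ∀ a, fderiv ℝ ρ p (horLift s a p) = fderiv ℝ ρ p (a, 0) := fun p hp a => by
    have : horLift s a p = (a, 0) + (0, horCoeff s a p) := by simp [horLift]
    rw [this, map_add, hvert p hp, add_zero]
  have hwedge : ∀ p ∈ Ω, ∀ a b,
      fderiv ℝ ρ p (a, 0) * flat L b p = fderiv ℝ ρ p (b, 0) * flat L a p := fun p hp a b => by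
    rw [← hhor p hp, ← hhor p hp, h.fderiv_hor_wedge hdim hρ hw hp]
  -- `∂ρ/∂xⁱ` does not depend on `y`, so the fibre derivative of `hwedge` only hits `flat L`.
  have hmixed (a c : E) : fderiv ℝ (fun p => fderiv ℝ ρ p (a, 0)) z (0, c) = 0 := by
    rw [fderiv_fderiv_const h.isOpen hρ hz, fderiv_fderiv_comm h.isOpen hρ hz,
      ← fderiv_fderiv_const h.isOpen hρ hz,
      fderiv_eq_of_eqOn (g' := fun _ => (0 : ℝ)) h.isOpen (fun p hp => hvert p hp c) hz]
    simp
  have hsmooth (a : E) := differentiableAt_of_contDiffOn h.isOpen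
    (contDiffOn_fderiv_apply (X := fun _ => (a, 0)) h.isOpen hρ contDiffOn_const) hz
  have hflat (a : E) := differentiableAt_of_contDiffOn h.isOpen (h.contDiffOn_flat a) hz
  have hprod (a b c : E) : fderiv ℝ (fun p => fderiv ℝ ρ p (a, 0) * flat L b p) z (0, c) =
      fderiv ℝ ρ z (a, 0) * hess L z c b := by
    rw [fderiv_fun_mul (hsmooth a) (hflat b)]
    simp [hmixed, h.fderiv_flat hz, hess]
  have hpar (a b : E) : fderiv ℝ ρ z (a, 0) • b - fderiv ℝ ρ z (b, 0) • a = 0 := by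
    refine h.eq_zero_of_hess hz fun c => ?_
    rw [hess_sub_right, hess_smul_right, hess_smul_right, ← hprod, ← hprod,
      fderiv_eq_of_eqOn h.isOpen (fun p hp => hwedge p hp a b) hz, sub_self]
  have hbase (a : E) : fderiv ℝ ρ z (a, 0) = 0 := by
    obtain ⟨c, hc⟩ := exists_notMem_span_pair hdim a a
    by_contra hne
    refine hc ((Submodule.smul_mem_iff _ hne).mp ?_)
    rw [sub_eq_zero.mp (hpar a c)]
    exact Submodule.smul_mem _ _ (Submodule.subset_span (by simp))
  ext v
  · simpa using hbase v
  · simpa using hvert z hz v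

/-- The flag curvature of a curvature tensor `R = ρ d_J L / 2 ∧ J` is `ρ`. -/
theorem flag_eq_of_wedge (h : IsLocalSpray L s Ω) (hz : z ∈ Ω)
    (hpos : ∀ a, a ≠ 0 → 0 < hess L z a a) {ρ : ℝ}
    (hw : ∀ a b, horCurv s a b z = ρ • (flat L a z • b - flat L b z • a)) {X : E}
    (hX : LinearIndependent ℝ ![z.2, X]) :
    hess L z X (horCurv s z.2 X z) /
      (hess L z z.2 z.2 * hess L z X X - hess L z z.2 X ^ 2) = ρ := by
  have h1 := hess_gram_pos hpos (h.hess_comm hz) hX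
  rw [div_eq_iff h1.ne', hw, hess_smul_right, hess_sub_right, hess_smul_right, hess_smul_right,
    h.hess_snd_left hz, h.hess_snd_left hz, h.hess_snd_right hz]
  ring

end IsLocalSpray

end Wedge

/-! ### The geodesic spray and its curvature in coordinates -/

section GeodesicSpray

variable {E : Type*} [NormedAddCommGroup E] [NormedSpace ℝ E] {L : E × E → ℝ} {f : E × E → ℝ}
  {s : E × E → E} {Ω : Set (E × E)} {z : E × E}

/-- The fibre Hessian `∂²L/∂yⁱ∂yʲ`, twice the metric tensor, as a map from vectors to covectors. -/
noncomputable def hessMap (L : E × E → ℝ) (z : E × E) : E →L[ℝ] E →L[ℝ] ℝ :=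
  ((ContinuousLinearMap.compL ℝ E (E × E) ℝ).flip (ContinuousLinearMap.inr ℝ E E)).comp
    ((fderiv ℝ (fderiv ℝ L) z).comp (ContinuousLinearMap.inr ℝ E E))

theorem hessMap_apply (a b : E) :
    hessMap L z a b = fderiv ℝ (fderiv ℝ L) z (0, a) (0, b) := rfl

theorem contDiffOn_hessMap (hΩ : IsOpen Ω) (hL : ContDiffOn ℝ ∞ L Ω) :
    ContDiffOn ℝ ∞ (hessMap L) Ω :=
  contDiffOn_const.clm_comp
    ((contDiffOn_fderiv hΩ (contDiffOn_fderiv hΩ hL)).clm_comp contDiffOn_const)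

/-- The covector that determines the fibre component of the spray. -/
noncomputable def sprayCovector (L : E × E → ℝ) (z : E × E) : E →L[ℝ] ℝ :=
  (fderiv ℝ L z).comp (ContinuousLinearMap.inl ℝ E E)
    - (fderiv ℝ (fderiv ℝ L) z (z.2, 0)).comp (ContinuousLinearMap.inr ℝ E E)

theorem contDiffOn_sprayCovector (hΩ : IsOpen Ω) (hL : ContDiffOn ℝ ∞ L Ω) :
    ContDiffOn ℝ ∞ (sprayCovector L) Ω :=
  ((contDiffOn_fderiv hΩ hL).clm_comp contDiffOn_const).sub
    (((contDiffOn_fderiv hΩ (contDiffOn_fderiv hΩ hL)).clm_apply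
      (contDiffOn_snd.prodMk contDiffOn_const)).clm_comp contDiffOn_const)

theorem exists_equiv_eq_hessMap [FiniteDimensional ℝ E]
    (hnd : ∀ a, (∀ b, fderiv ℝ (fderiv ℝ L) z (0, a) (0, b) = 0) → a = 0) :
    ∃ e : E ≃L[ℝ] (E →L[ℝ] ℝ), (e : E →L[ℝ] E →L[ℝ] ℝ) = hessMap L z := by
  have hinj : Function.Injective (hessMap L z : E →ₗ[ℝ] E →L[ℝ] ℝ) := by
    rw [injective_iff_map_eq_zero]
    intro a ha
    exact hnd a fun b => DFunLike.congr_fun ha b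
  have hfin : Module.finrank ℝ E = Module.finrank ℝ (E →L[ℝ] ℝ) := by
    rw [← (LinearMap.toContinuousLinearMap (𝕜 := ℝ) (E := E) (F' := ℝ)).finrank_eq,
      Module.finrank_linearMap, Module.finrank_self, mul_one]
  exact ⟨(LinearEquiv.ofInjectiveOfFinrankEq _ hinj hfin).toContinuousLinearEquiv, by ext; rfl⟩

/-- The Euler-Lagrange equations can be solved for a smooth spray. -/
theorem exists_isLocalSpray [FiniteDimensional ℝ E] (hΩ : IsOpen Ω) (hL : ContDiffOn ℝ ∞ L Ω)
    (heuler : ∀ z ∈ Ω, fderiv ℝ L z (0, z.2) = 2 * L z)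
    (hnd : ∀ z ∈ Ω, ∀ a, (∀ b, fderiv ℝ (fderiv ℝ L) z (0, a) (0, b) = 0) → a = 0) :
    ∃ s, IsLocalSpray L s Ω := by
  refine ⟨fun z => (hessMap L z).inverse (sprayCovector L z), hΩ, hL, fun z hz => ?_, heuler,
    fun z hz c => ?_, hnd⟩
  · obtain ⟨e, he⟩ := exists_equiv_eq_hessMap (hnd z hz)
    have h1 : ContDiffAt ℝ ∞ ContinuousLinearMap.inverse (hessMap L z) := by
      rw [← he]; exact contDiffAt_map_inverse e
    have h2 : ContDiffAt ℝ ∞ (fun z => (hessMap L z).inverse) z :=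
      h1.comp z ((contDiffOn_hessMap hΩ hL).contDiffAt (hΩ.mem_nhds hz))
    exact (h2.clm_apply
      ((contDiffOn_sprayCovector hΩ hL).contDiffAt (hΩ.mem_nhds hz))).contDiffWithinAt
  · obtain ⟨e, he⟩ := exists_equiv_eq_hessMap (hnd z hz)
    have h1 : hessMap L z ((hessMap L z).inverse (sprayCovector L z)) = sprayCovector L z := by
      rw [← he, ContinuousLinearMap.inverse_equiv]; exact e.apply_symm_apply _
    have h2 := DFunLike.congr_fun h1 c
    rw [hessMap_apply] at h2
    have h3 (v : E) : (z.2, v) = (z.2, (0 : E)) + (0, v) := by simp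
    rw [h3, map_add, add_apply, h2]
    simp [sprayCovector]

theorem dOne_dJ (hΩ : IsOpen Ω) (hL : ContDiffOn ℝ ∞ L Ω) (hz : z ∈ Ω) (u w : E × E) :
    dOne (dJ L) z u w = fderiv ℝ (fderiv ℝ L) z u (0, w.1)
      - fderiv ℝ (fderiv ℝ L) z w (0, u.1) := by
  have h1 : HasFDerivAt (dJ L) _ z :=
    (((ContinuousLinearMap.compL ℝ (E × E) (E × E) ℝ).flip vertEndo).hasFDerivAt).comp z
      (differentiableAt_of_contDiffOn hΩ (contDiffOn_fderiv hΩ hL) hz).hasFDerivAt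
  rw [dOne, h1.fderiv]
  rfl

namespace IsLocalSpray

/-- The Euler-Lagrange equations, with `y` as base component, single out the geodesic spray. -/
theorem geodesicSpray_eq (h : IsLocalSpray (fun p => f p ^ 2) s Ω) (hz : z ∈ Ω) :
    geodesicSpray f z = (z.2, s z) := by
  set L := fun p => f p ^ 2 with hLdef
  have hS : ∀ w : E × E, dOne (dJ L) z (z.2, s z) w = -fderiv ℝ L z w := fun w => by
    have h1 := h.fderiv_euler hz w
    have h2 : fderiv ℝ L z w = fderiv ℝ L z (w.1, 0) + fderiv ℝ L z (0, w.2) := by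
      rw [← map_add]; simp
    rw [dOne_dJ h.isOpen h.smooth_energy hz, h.eulerLagrange z hz]
    simp only
    linarith
  have hσ : ∀ w : E × E, dOne (dJ L) z (geodesicSpray f z) w = -fderiv ℝ L z w :=
    Classical.epsilon_spec (p := fun σ : E × E => ∀ w : E × E,
      dOne (dJ L) z σ w = -fderiv ℝ L z w) ⟨_, hS⟩
  set σ := geodesicSpray f z
  have hdiff (w : E × E) : fderiv ℝ (fderiv ℝ L) z (σ - (z.2, s z)) (0, w.1)
      = fderiv ℝ (fderiv ℝ L) z w (0, (σ - (z.2, s z)).1) := by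
    have h1 := (hσ w).trans (hS w).symm
    rw [dOne_dJ h.isOpen h.smooth_energy hz, dOne_dJ h.isOpen h.smooth_energy hz] at h1
    have h2 : ((0 : E), (σ - (z.2, s z)).1) = (0, σ.1) - (0, z.2) := by simp
    rw [h2, map_sub, map_sub, sub_apply]
    linarith
  have hfst : (σ - (z.2, s z)).1 = 0 := h.nondegenerate z hz _ fun b => by
    rw [fderiv_fderiv_comm h.isOpen h.smooth_energy hz, ← hdiff (0, b)]
    exact map_zero _
  have hsnd : (σ - (z.2, s z)).2 = 0 := h.nondegenerate z hz _ fun b => by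
    have h1 := hdiff (b, 0)
    have h2 : σ - (z.2, s z) = (0, (σ - (z.2, s z)).2) := Prod.ext hfst rfl
    rw [hfst, ← Prod.zero_eq_mk, map_zero, h2] at h1
    exact h1
  exact sub_eq_zero.mp (Prod.ext hfst hsnd)

/-- `h = (1/2) (Id - [S, J])` annihilates vertical vectors and lifts `a` to `(a, -N a)`. -/
theorem horProj_eq (h : IsLocalSpray (fun p => f p ^ 2) s Ω) (hz : z ∈ Ω) (u : E × E) :
    horProj f z u = horLift s u.1 z := by
  have hS : Set.EqOn (geodesicSpray f) (fun p => (p.2, s p)) Ω := fun p hp => h.geodesicSpray_eq hp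
  have hb (w : E × E) : lieBracket ℝ (geodesicSpray f) (fun _ => w) z
      = -(w.2, fderiv ℝ s z w) := by
    rw [lieBracket_eq_of_eqOn h.isOpen hS (fun _ _ => rfl) hz, VectorField.lieBracket,
      h.fderiv_sprayField hz]
    simp
  rw [horProj, fnBracketField, hb, hb]
  ext
  · simp only [vertEndo, horLift, ContinuousLinearMap.comp_apply, ContinuousLinearMap.coe_fst',
      ContinuousLinearMap.inr_apply, Prod.smul_fst, Prod.fst_sub, Prod.fst_neg]
    module
  · simp only [vertEndo, horLift, horCoeff, ContinuousLinearMap.comp_apply,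
      ContinuousLinearMap.coe_fst', ContinuousLinearMap.inr_apply, Prod.smul_snd, Prod.snd_sub,
      Prod.snd_neg, Prod.fst_neg]
    module

theorem curvature_eq (h : IsLocalSpray (fun p => f p ^ 2) s Ω) (hz : z ∈ Ω) (u w : E × E) :
    curvature f z u w = (0, horCurv s u.1 w.1 z) := by
  have hh (u : E × E) : Set.EqOn (fun p => horProj f p u) (horLift s u.1) Ω :=
    fun p hp => h.horProj_eq hp u
  have hvert (v : E × E) (hv : v.1 = 0) : horProj f z v = 0 := by
    rw [h.horProj_eq hz, hv]; simp [horLift, horCoeff, ← Prod.zero_eq_mk]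
  have h1 : horProj f z (lieBracket ℝ (fun _ => u) (fun _ => w) z) = 0 := by
    apply hvert; simp [VectorField.lieBracket]
  have h2 (u w : E × E) :
      horProj f z (lieBracket ℝ (fun p => horProj f p u) (fun _ => w) z) = 0 := by
    apply hvert
    rw [lieBracket_eq_of_eqOn h.isOpen (hh u) (fun _ _ => rfl) hz, VectorField.lieBracket,
      h.fderiv_horLift hz]
    simp
  have h3 (u w : E × E) :
      horProj f z (lieBracket ℝ (fun _ => u) (fun p => horProj f p w) z) = 0 := by
    apply hvert
    rw [lieBracket_eq_of_eqOn h.isOpen (fun _ _ => rfl) (hh w) hz, VectorField.lieBracket,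
      h.fderiv_horLift hz]
    simp
  rw [curvature, fnBracket, h1, h2, h3, hvert 0 rfl,
    lieBracket_eq_of_eqOn h.isOpen (hh u) (hh w) hz, h.lieBracket_horLift hz]
  simp only [add_zero, sub_zero]
  rw [← two_smul ℝ, smul_smul]
  norm_num

theorem flagCurvature_eq (h : IsLocalSpray (fun p => f p ^ 2) s Ω) (hz : z ∈ Ω) (X : E) :
    flagCurvature f z X = hess (fun p => f p ^ 2) z X (horCurv s z.2 X z) /
      (hess (fun p => f p ^ 2) z z.2 z.2 * hess (fun p => f p ^ 2) z X X
        - hess (fun p => f p ^ 2) z z.2 X ^ 2) := by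
  rw [flagCurvature, h.curvature_eq hz]; rfl

end IsLocalSpray

end GeodesicSpray

/-! ### Positive definiteness of the metric tensor -/

/-- The second order necessary condition at a local minimum. -/
theorem _root_.IsLocalMin.second_deriv_nonneg {φ ψ : ℝ → ℝ} {t d : ℝ} (hmin : IsLocalMin φ t)
    (hφ : ∀ᶠ r in 𝓝 t, HasDerivAt φ (ψ r) r) (hψ : HasDerivAt ψ d t) : 0 ≤ d := by
  by_contra! hd
  have h1 : deriv (-φ) =ᶠ[𝓝 t] -ψ := hφ.mono fun r hr => hr.neg.deriv
  have h0 : ψ t = 0 := hmin.hasDerivAt_eq_zero hφ.self_of_nhds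
  have h2 : IsLocalMin (-φ) t := by
    refine isLocalMin_of_deriv_deriv_pos ?_ ?_ hφ.self_of_nhds.continuousAt.neg
    · rw [h1.deriv_eq, hψ.neg.deriv]; linarith
    · rw [h1.self_of_nhds, Pi.neg_apply, h0, neg_zero]
  -- A strict maximum which is a minimum: `φ` is constant near `t`.
  have h3 : φ =ᶠ[𝓝 t] fun _ => φ t := by
    filter_upwards [hmin, h2] with r hr hr'
    simp only [Pi.neg_apply] at hr'
    linarith
  have h4 : ψ =ᶠ[𝓝 t] fun _ => 0 := by
    filter_upwards [h3.eventuallyEq_nhds, hφ] with r hr hr'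
    rw [← hr'.deriv, hr.deriv_eq, deriv_const]
  have h5 := hψ.deriv
  rw [h4.deriv_eq, deriv_const] at h5
  exact hd.ne h5.symm

section PosDef

variable {E : Type*} [NormedAddCommGroup E] [InnerProductSpace ℝ E]
  {L : E × E → ℝ} {s : E × E → E} {Ω : Set (E × E)} {x : E}

namespace IsLocalSpray

/-- At a minimum point of `L / ‖y‖²` on the unit sphere the metric tensor is positive definite. -/
theorem exists_hess_pos [FiniteDimensional ℝ E] [Nontrivial E] (h : IsLocalSpray L s Ω)
    (hx : ∀ y, y ≠ 0 → (x, y) ∈ Ω)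
    (hL : ∀ y, y ≠ 0 → 0 < L (x, y))
    (hhom : ∀ (y : E) (c : ℝ), 0 < c → L (x, c • y) = c ^ 2 * L (x, y)) :
    ∃ y, y ≠ 0 ∧ ∀ a, a ≠ 0 → 0 < hess L (x, y) a a := by
  have hne (y : E) (hy : y ∈ Metric.sphere (0 : E) 1) : y ≠ 0 := by
    rintro rfl; simp at hy
  have hcont : ContinuousOn (fun y => L (x, y)) (Metric.sphere (0 : E) 1) :=
    h.smooth_energy.continuousOn.comp (by fun_prop) fun y hy => hx y (hne y hy)
  obtain ⟨y, hy, hmin⟩ := (isCompact_sphere (0 : E) 1).exists_isMinOn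
    (NormedSpace.sphere_nonempty.mpr zero_le_one) hcont
  have hy0 := hne y hy
  have hy1 : ‖y‖ = 1 := by simpa using hy
  set m := L (x, y) with hm
  have hm0 : 0 < m := hL y hy0
  have hbound (v : E) (hv : v ≠ 0) : m * ‖v‖ ^ 2 ≤ L (x, v) := by
    have hv' : 0 < ‖v‖ := norm_pos_iff.mpr hv
    have h1 : m ≤ L (x, ‖v‖⁻¹ • v) := hmin (by simp [norm_smul, hv'.ne'])
    have h2 := hhom (‖v‖⁻¹ • v) ‖v‖ hv'
    rw [smul_smul, mul_inv_cancel₀ hv'.ne', one_smul] at h2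
    rw [h2, mul_comm]
    gcongr
  refine ⟨y, hy0, fun a ha => ?_⟩
  have hmem : ∀ᶠ t : ℝ in 𝓝 0, y + t • a ≠ 0 := by
    have hc : ContinuousAt (fun t : ℝ => y + t • a) 0 := by fun_prop
    exact hc.eventually_ne (by simpa using hy0)
  have hmin' : IsLocalMin (fun t : ℝ => L ((x, y) + t • ((0 : E), a)) - m * ‖y + t • a‖ ^ 2) 0 := by
    filter_upwards [hmem] with t ht
    have h1 := hbound _ ht
    simp only [zero_smul, add_zero, hy1, Prod.smul_mk, smul_zero, Prod.mk_add_mk, ← hm]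
    linarith
  have hline (t : ℝ) : HasDerivAt (fun t : ℝ => y + t • a) a t := by
    simpa using ((hasDerivAt_id t).smul_const a).const_add y
  have hφ : ∀ᶠ t : ℝ in 𝓝 0,
      HasDerivAt (fun t : ℝ => L ((x, y) + t • ((0 : E), a)) - m * ‖y + t • a‖ ^ 2)
        (fderiv ℝ L ((x, y) + t • ((0 : E), a)) (0, a) - m * (2 * inner ℝ (y + t • a) a)) t := by
    filter_upwards [hmem] with t ht
    refine HasDerivAt.sub ?_ ((hline t).norm_sq.const_mul m)
    have hz : (x, y) + t • ((0 : E), a) ∈ Ω := by simpa using hx _ ht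
    have h1 := (hasDerivAt_comp_line h.isOpen hz (0, a) h.smooth_energy)
    have h2 : HasDerivAt (fun r : ℝ => r - t) 1 t := (hasDerivAt_id t).sub_const t
    have h3 := HasDerivAt.scomp (𝕜' := ℝ) t (by simpa using h1) h2
    refine (h3.congr_of_eventuallyEq (Filter.Eventually.of_forall fun r => ?_)).congr_deriv ?_
    · simp [sub_smul]
    · simp
  have hψ : HasDerivAt (fun t : ℝ => fderiv ℝ L ((x, y) + t • ((0 : E), a)) (0, a)
      - m * (2 * inner ℝ (y + t • a) a))
      (fderiv ℝ (fderiv ℝ L) (x, y) (0, a) (0, a) - m * (2 * inner ℝ a a)) 0 := by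
    have h1 := hasDerivAt_comp_line h.isOpen (hx y hy0) (0, a)
      (contDiffOn_fderiv_apply (X := fun _ => (0, a)) h.isOpen h.smooth_energy contDiffOn_const)
    rw [fderiv_fderiv_const h.isOpen h.smooth_energy (hx y hy0)] at h1
    have h2 : HasDerivAt (fun t : ℝ => inner ℝ (y + t • a) a) (inner ℝ a a) 0 := by
      simpa using (hline 0).inner ℝ (hasDerivAt_const (0 : ℝ) a)
    exact h1.sub ((h2.const_mul 2).const_mul m)
  have h1 := hmin'.second_deriv_nonneg hφ hψ
  have h2 : 0 < inner ℝ a a := real_inner_self_pos.mpr ha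
  have h3 := mul_pos hm0 h2
  rw [hess]
  linarith

theorem continuousAt_hess (h : IsLocalSpray L s Ω) {y : E} (hy : (x, y) ∈ Ω) (a : E) :
    ContinuousAt (fun p : E × E => hess L (x, p.1) p.2 p.2) (y, a) := by
  have h1 : ContinuousAt (fderiv ℝ (fderiv ℝ L)) (x, y) :=
    ((contDiffOn_fderiv h.isOpen (contDiffOn_fderiv h.isOpen
      h.smooth_energy)).contDiffAt (h.isOpen.mem_nhds hy)).continuousAt
  have h2 : ContinuousAt (fun p : E × E => fderiv ℝ (fderiv ℝ L) (x, p.1)) (y, a) :=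
    ContinuousAt.comp (f := fun p : E × E => (x, p.1)) (g := fderiv ℝ (fderiv ℝ L)) h1
      (by fun_prop)
  have h3 : ContinuousAt (fun p : E × E => ((0 : E), p.2)) (y, a) := by fun_prop
  exact ((h2.clm_apply h3).clm_apply h3).const_mul _

theorem isOpen_setOf_hess_pos [FiniteDimensional ℝ E]
    (h : IsLocalSpray L s Ω) (hx : ∀ y, y ≠ 0 → (x, y) ∈ Ω) :
    IsOpen {y | y ≠ 0 ∧ ∀ a, a ≠ 0 → 0 < hess L (x, y) a a} := by
  rw [isOpen_iff_mem_nhds]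
  rintro y ⟨hy, hpos⟩
  have h1 : ∀ᶠ v in 𝓝 y, ∀ a ∈ Metric.sphere (0 : E) 1, 0 < hess L (x, v) a a := by
    refine (isCompact_sphere (0 : E) 1).eventually_forall_of_forall_eventually fun a ha => ?_
    have ha0 : a ≠ 0 := by rintro rfl; simp at ha
    exact (h.continuousAt_hess (hx y hy) a).eventually (lt_mem_nhds (hpos a ha0))
  filter_upwards [h1, isOpen_ne.mem_nhds hy] with v hv hv0
  refine ⟨hv0, fun a ha => ?_⟩
  have ha' : 0 < ‖a‖ := norm_pos_iff.mpr ha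
  have h2 := hv (‖a‖⁻¹ • a) (by simp [norm_smul, ha'.ne'])
  rw [hess_smul_left, hess_smul_right] at h2
  exact pos_of_mul_pos_right (pos_of_mul_pos_right h2 (by positivity)) (by positivity)

/-- A nondegenerate positive semidefinite form is positive definite. -/
theorem hess_pos_of_nonneg (h : IsLocalSpray L s Ω) {z : E × E} (hz : z ∈ Ω)
    (hnn : ∀ a, 0 ≤ hess L z a a) {a : E} (ha : a ≠ 0) : 0 < hess L z a a := by
  refine (hnn a).lt_of_ne' fun h0 => ha (h.eq_zero_of_hess hz fun b => ?_)
  -- If `g(a, a) = 0`, a combination of `a` and `b` has negative square unless `g(a, b) = 0`.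
  have h2 := hnn ((-hess L z b a) • b + (hess L z b b + 1) • a)
  simp only [hess_add_left, hess_add_right, hess_smul_left, hess_smul_right, h0,
    h.hess_comm hz a b] at h2
  have h3 := hnn b
  have h4 : hess L z b a ^ 2 * (hess L z b b + 2) ≤ 0 := by nlinarith
  have h5 : hess L z b a ^ 2 ≤ 0 := by nlinarith [sq_nonneg (hess L z b a)]
  exact pow_eq_zero_iff two_ne_zero |>.mp (le_antisymm h5 (sq_nonneg _))

/-- The metric tensor of a positive Finsler function is positive definite: it is so at one point
of each fibre, and nondegeneracy prevents a change of signature. -/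
theorem hess_pos [FiniteDimensional ℝ E] (h : IsLocalSpray L s Ω) (hdim : 1 < Module.finrank ℝ E)
    (hx : ∀ y, y ≠ 0 → (x, y) ∈ Ω) (hL : ∀ y, y ≠ 0 → 0 < L (x, y))
    (hhom : ∀ (y : E) (c : ℝ), 0 < c → L (x, c • y) = c ^ 2 * L (x, y)) {y : E} (hy : y ≠ 0)
    {a : E} (ha : a ≠ 0) : 0 < hess L (x, y) a a := by
  have : Nontrivial E := ⟨y, 0, hy⟩
  have hconn : IsPreconnected ({0}ᶜ : Set E) :=
    (isConnected_compl_singleton_of_one_lt_rank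
      (Module.lt_rank_of_lt_finrank hdim) 0).isPreconnected
  have hsub := hconn.subset_of_closure_inter_subset (h.isOpen_setOf_hess_pos hx)
    (by
      obtain ⟨v, hv, hv'⟩ := h.exists_hess_pos hx hL hhom
      exact ⟨v, hv, hv, hv'⟩)
    (by
      rintro v ⟨hv, hv0⟩
      refine ⟨hv0, fun b hb => h.hess_pos_of_nonneg (hx v hv0) (fun c => ?_) hb⟩
      by_contra! hneg
      have hc : ContinuousAt (fun w => hess L (x, w) c c) v :=
        ContinuousAt.comp (f := fun w => (w, c)) (g := fun p : E × E => hess L (x, p.1) p.2 p.2)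
          (h.continuousAt_hess (hx v hv0) c) (by fun_prop)
      obtain ⟨w, hw, hw'⟩ := ((mem_closure_iff_frequently.mp hv).and_eventually
        (hc.eventually (gt_mem_nhds hneg))).exists
      have hc0 : c ≠ 0 := by
        rintro rfl
        simp [hess, ← Prod.zero_eq_mk] at hneg
      exact lt_asymm hw' (hw.2 c hc0))
  exact (hsub hy).2 a ha

end IsLocalSpray

end PosDef

/-! ### Finsler metrics in induced coordinates -/

section Charts

variable {n : ℕ} {M : Type*} [TopologicalSpace M] [ChartedSpace (EuclideanSpace ℝ (Fin n)) M]
  {φ : OpenPartialHomeomorph M (EuclideanSpace ℝ (Fin n))}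
local notation "𝔼" => EuclideanSpace ℝ (Fin n)

theorem contMDiff_toTangentBundle :
    ContMDiff 𝓘(ℝ, 𝔼 × 𝔼) (𝓡 n).tangent ∞
      (fun z : 𝔼 × 𝔼 => (⟨z.1, z.2⟩ : TangentBundle (𝓡 n) 𝔼)) := by
  have h := contMDiff_tangentBundleModelSpaceHomeomorph_symm (n := ∞) (I := 𝓡 n)
  rw [modelWithCornersSelf_prod]
  exact h

theorem isOpen_slitDomain {M : Type*} [TopologicalSpace M] {φ : OpenPartialHomeomorph M 𝔼} :
    IsOpen (slitDomain φ) :=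
  (φ.open_target.preimage continuous_fst).inter (isOpen_ne.preimage continuous_snd)

theorem mdifferentiableAt_symm (hφ : φ ∈ IsManifold.maximalAtlas (𝓡 n) ∞ M) {x : 𝔼}
    (hx : x ∈ φ.target) : MDifferentiableAt (𝓡 n) (𝓡 n) φ.symm x :=
  ((contMDiffOn_symm_of_mem_maximalAtlas hφ).contMDiffAt
    (φ.open_target.mem_nhds hx)).mdifferentiableAt (by simp)

/-- The differential of a chart, as an isomorphism from coordinate vectors to tangent vectors. -/
theorem exists_equiv_eq_mfderiv_symm (hφ : φ ∈ IsManifold.maximalAtlas (𝓡 n) ∞ M) {x : 𝔼}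
    (hx : x ∈ φ.target) : ∃ e : 𝔼 ≃L[ℝ] TangentSpace (𝓡 n) (φ.symm x),
      ∀ y, e y = mfderiv (𝓡 n) (𝓡 n) φ.symm x y := by
  have hd : φ.MDifferentiable (𝓡 n) (𝓡 n) :=
    ⟨(contMDiffOn_of_mem_maximalAtlas hφ).mdifferentiableOn (by simp),
      (contMDiffOn_symm_of_mem_maximalAtlas hφ).mdifferentiableOn (by simp)⟩
  exact ⟨hd.symm.mfderiv hx, fun y => rfl⟩

theorem bundleParam_snd_ne_zero (hφ : φ ∈ IsManifold.maximalAtlas (𝓡 n) ∞ M) {z : 𝔼 × 𝔼}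
    (hz : z ∈ slitDomain φ) : (bundleParam φ z).2 ≠ 0 := by
  obtain ⟨e, he⟩ := exists_equiv_eq_mfderiv_symm hφ hz.1
  change mfderiv (𝓡 n) (𝓡 n) φ.symm z.1 z.2 ≠ 0
  rw [← he]
  simpa using hz.2

/-- Induced coordinates reach every tangent vector over the domain of the chart. -/
theorem exists_bundleParam_eq (hφ : φ ∈ IsManifold.maximalAtlas (𝓡 n) ∞ M)
    {p : TangentBundle (𝓡 n) M} (hp : p.proj ∈ φ.source) :
    ∃ y, bundleParam φ (φ p.proj, y) = p := by
  obtain ⟨p, v⟩ := p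
  have hx : φ p ∈ φ.target := φ.map_source hp
  obtain ⟨e, he⟩ := exists_equiv_eq_mfderiv_symm hφ hx
  have hs : φ.symm (φ p) = p := φ.left_inv hp
  have key : ∀ q : M, φ.symm (φ p) = q → ∀ v : TangentSpace (𝓡 n) q,
      ∃ y, bundleParam φ (φ p, y) = ⟨q, v⟩ := by
    rintro q rfl v
    refine ⟨e.symm v, ?_⟩
    simp only [bundleParam, ← he]
    congr 1
    exact e.apply_symm_apply v
  exact key p hs v

variable [IsManifold (𝓡 n) ∞ M]

theorem contMDiffOn_bundleParam (hφ : φ ∈ IsManifold.maximalAtlas (𝓡 n) ∞ M) :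
    ContMDiffOn 𝓘(ℝ, 𝔼 × 𝔼) (𝓡 n).tangent ∞ (bundleParam φ) {z | z.1 ∈ φ.target} := by
  have : IsManifold (𝓡 n) 1 M := IsManifold.of_le (n := ∞) (by simp)
  have h1 := (contMDiffOn_symm_of_mem_maximalAtlas hφ).contMDiffOn_tangentMapWithin
    (m := ∞) (by simp) φ.open_target.uniqueMDiffOn
  have h2 := h1.comp (contMDiff_toTangentBundle (n := n)).contMDiffOn
    (s := {z : 𝔼 × 𝔼 | z.1 ∈ φ.target}) (fun z hz => hz)
  refine h2.congr fun z hz => ?_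
  simp only [Function.comp_apply, tangentMapWithin, bundleParam]
  rw [mfderivWithin_of_isOpen φ.open_target hz]

theorem mdifferentiableAt_bundleParam (hφ : φ ∈ IsManifold.maximalAtlas (𝓡 n) ∞ M) {z : 𝔼 × 𝔼}
    (hz : z.1 ∈ φ.target) :
    MDifferentiableAt 𝓘(ℝ, 𝔼 × 𝔼) (𝓡 n).tangent (bundleParam φ) z :=
  ((contMDiffOn_bundleParam hφ).contMDiffAt
    ((φ.open_target.preimage continuous_fst).mem_nhds hz)).mdifferentiableAt (by simp)

/-- The projection `π` reads `(x, y) ↦ x` in induced coordinates. -/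
theorem mfderiv_proj_bundleParam (hφ : φ ∈ IsManifold.maximalAtlas (𝓡 n) ∞ M) {z : 𝔼 × 𝔼}
    (hz : z.1 ∈ φ.target) (u : 𝔼 × 𝔼) :
    mfderiv (𝓡 n).tangent (𝓡 n) (fun p : TangentBundle (𝓡 n) M => p.proj) (bundleParam φ z)
      (mfderiv 𝓘(ℝ, 𝔼 × 𝔼) (𝓡 n).tangent (bundleParam φ) z u) =
    mfderiv (𝓡 n) (𝓡 n) φ.symm z.1 u.1 := by
  have : IsManifold (𝓡 n) 1 M := IsManifold.of_le (n := ∞) (by simp)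
  have hπ : MDifferentiableAt (𝓡 n).tangent (𝓡 n) (fun p : TangentBundle (𝓡 n) M => p.proj)
      (bundleParam φ z) :=
    (Bundle.contMDiff_proj (n := 1) (IB := 𝓡 n)
      (TangentSpace (𝓡 n) : M → Type _)).mdifferentiable (by simp) _
  have h1 := mfderiv_comp z hπ (mdifferentiableAt_bundleParam hφ hz)
  have h2 : mfderiv 𝓘(ℝ, 𝔼 × 𝔼) (𝓡 n) (φ.symm ∘ Prod.fst) z = _ :=
    mfderiv_comp z (mdifferentiableAt_symm hφ hz) (differentiableAt_fst.mdifferentiableAt)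
  have h3 : (fun p : TangentBundle (𝓡 n) M => p.proj) ∘ bundleParam φ = φ.symm ∘ Prod.fst := rfl
  rw [h3, h2, mfderiv_eq_fderiv, fderiv_fst] at h1
  exact (DFunLike.congr_fun h1 u).symm

namespace IsFinslerMetric

variable {F : TangentBundle (𝓡 n) M → ℝ}

theorem contDiffOn_inChart (hF : IsFinslerMetric F)
    (hφ : φ ∈ IsManifold.maximalAtlas (𝓡 n) ∞ M) : ContDiffOn ℝ ∞ (inChart F φ) (slitDomain φ) := by
  rw [← contMDiffOn_iff_contDiffOn]
  exact hF.smooth.comp ((contMDiffOn_bundleParam hφ).mono fun z hz => hz.1)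
    fun z hz => bundleParam_snd_ne_zero hφ hz

theorem inChart_pos (hF : IsFinslerMetric F) (hφ : φ ∈ IsManifold.maximalAtlas (𝓡 n) ∞ M)
    {z : 𝔼 × 𝔼} (hz : z ∈ slitDomain φ) : 0 < inChart F φ z :=
  hF.pos _ (bundleParam_snd_ne_zero hφ hz)

theorem inChart_smul (hF : IsFinslerMetric F) (x y : 𝔼) {c : ℝ} (hc : 0 < c) :
    inChart F φ (x, c • y) = c * inChart F φ (x, y) := by
  have h := hF.homogeneous (φ.symm x) (mfderiv (𝓡 n) (𝓡 n) φ.symm x y) c hc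
  have e : mfderiv (𝓡 n) (𝓡 n) φ.symm x (c • y) = c • mfderiv (𝓡 n) (𝓡 n) φ.symm x y :=
    ContinuousLinearMap.map_smul _ c y
  change F ⟨φ.symm x, mfderiv (𝓡 n) (𝓡 n) φ.symm x (c • y)⟩ = _
  rw [e]
  exact h

/-- Euler's relation for `F²`, homogeneous of degree two in `y`. -/
theorem euler_inChart (hF : IsFinslerMetric F) (hφ : φ ∈ IsManifold.maximalAtlas (𝓡 n) ∞ M)
    {z : 𝔼 × 𝔼} (hz : z ∈ slitDomain φ) :
    fderiv ℝ (fun p => inChart F φ p ^ 2) z (0, z.2) = 2 * inChart F φ z ^ 2 := by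
  have h1 := hasDerivAt_comp_line isOpen_slitDomain hz (0, z.2) ((hF.contDiffOn_inChart hφ).pow 2)
  have h2 : HasDerivAt (fun t : ℝ => (1 + t) ^ 2 * inChart F φ z ^ 2)
      (2 * inChart F φ z ^ 2) 0 := by
    have := (((hasDerivAt_id (0 : ℝ)).const_add 1).pow 2).mul_const (inChart F φ z ^ 2)
    simpa using this
  refine h1.unique (h2.congr_of_eventuallyEq ?_)
  filter_upwards [lt_mem_nhds (show (-1 : ℝ) < 0 by norm_num)] with t ht
  have h3 : z + t • ((0 : 𝔼), z.2) = (z.1, (1 + t) • z.2) := by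
    ext <;> simp [add_smul]
  rw [h3, hF.inChart_smul _ _ (by linarith), mul_pow]

/-- In induced coordinates a Finsler metric has a smooth geodesic spray. -/
theorem exists_isLocalSpray (hF : IsFinslerMetric F)
    (hφ : φ ∈ IsManifold.maximalAtlas (𝓡 n) ∞ M) :
    ∃ s, IsLocalSpray (fun p => inChart F φ p ^ 2) s (slitDomain φ) := by
  refine Finsler.exists_isLocalSpray isOpen_slitDomain ((hF.contDiffOn_inChart hφ).pow 2)
    (fun z hz => hF.euler_inChart hφ hz) fun z hz a ha => ?_
  refine hF.nondegenerate φ hφ z hz a fun b => ?_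
  rw [metric, ha, mul_zero]

theorem hess_inChart_pos (hF : IsFinslerMetric F) (hφ : φ ∈ IsManifold.maximalAtlas (𝓡 n) ∞ M)
    (hn : 1 < n) {z : 𝔼 × 𝔼} (hz : z ∈ slitDomain φ) {a : 𝔼} (ha : a ≠ 0) :
    0 < hess (fun p => inChart F φ p ^ 2) z a a := by
  obtain ⟨s, h⟩ := hF.exists_isLocalSpray hφ
  have hx (y : 𝔼) (hy : y ≠ 0) : (z.1, y) ∈ slitDomain φ := ⟨hz.1, hy⟩
  exact h.hess_pos (x := z.1) (by simpa using hn) hx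
    (fun y hy => pow_pos (hF.inChart_pos hφ (hx y hy)) 2)
    (fun y c hc => by rw [hF.inChart_smul _ _ hc, mul_pow]) hz.2 ha

end IsFinslerMetric

end Charts

/-! ### Semi-basic forms and the global argument -/

section Forms

variable {n : ℕ} {M : Type*} [TopologicalSpace M] [ChartedSpace (EuclideanSpace ℝ (Fin n)) M]
  {φ : OpenPartialHomeomorph M (EuclideanSpace ℝ (Fin n))}

local notation "𝔼" => EuclideanSpace ℝ (Fin n)

variable [IsManifold (𝓡 n) ∞ M] {F : TangentBundle (𝓡 n) M → ℝ}
  {ξ : ∀ z : TangentBundle (𝓡 n) M, TangentSpace (𝓡 n).tangent z →L[ℝ] ℝ}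

/-- The semi-basic `1`-form `(κ / 2) d_J F²`, defined without coordinates: the derivative of `F²`
along the fibre, composed with the differential of the projection. -/
noncomputable def energyForm (F : TangentBundle (𝓡 n) M → ℝ) (κ : ℝ)
    (z : TangentBundle (𝓡 n) M) : TangentSpace (𝓡 n).tangent z →L[ℝ] ℝ :=
  ((κ / 2) • (fderiv ℝ (fun v : 𝔼 => F ⟨z.proj, v⟩ ^ 2) z.2 : 𝔼 →L[ℝ] ℝ)).comp
    (mfderiv (𝓡 n).tangent (𝓡 n) (fun p : TangentBundle (𝓡 n) M => p.proj) z)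

theorem formInChart_energyForm (hF : IsFinslerMetric F)
    (hφ : φ ∈ IsManifold.maximalAtlas (𝓡 n) ∞ M) (κ : ℝ) {z : 𝔼 × 𝔼} (hz : z ∈ slitDomain φ)
    (u : 𝔼 × 𝔼) :
    formInChart (energyForm F κ) φ z u = κ * flat (fun p => inChart F φ p ^ 2) u.1 z := by
  obtain ⟨e, he⟩ := exists_equiv_eq_mfderiv_symm hφ hz.1
  let e' : 𝔼 ≃L[ℝ] 𝔼 := e
  let G : 𝔼 → ℝ := fun v => F ⟨φ.symm z.1, v⟩ ^ 2
  have h1 : formInChart (energyForm F κ) φ z u = (κ / 2) * fderiv ℝ G (e' z.2) (e' u.1) := by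
    have h2 := mfderiv_proj_bundleParam hφ hz.1 u
    rw [← he] at h2
    have h3 : e' z.2 = (bundleParam φ z).2 := he z.2
    rw [h3]
    change (κ / 2) * fderiv ℝ G (bundleParam φ z).2 (mfderiv (𝓡 n).tangent (𝓡 n)
      (fun p : TangentBundle (𝓡 n) M => p.proj) (bundleParam φ z)
      (mfderiv 𝓘(ℝ, 𝔼 × 𝔼) (𝓡 n).tangent (bundleParam φ) z u)) = _
    rw [h2]
    rfl
  have h4 : fderiv ℝ (G ∘ e') z.2 u.1 = fderiv ℝ G (e' z.2) (e' u.1) := by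
    rw [e'.comp_right_fderiv]; rfl
  have h5 : G ∘ e' = fun y => inChart F φ (z.1, y) ^ 2 := by
    funext y
    change F ⟨φ.symm z.1, e y⟩ ^ 2 = _
    rw [he]; rfl
  have h6 : HasFDerivAt (fun y : 𝔼 => inChart F φ (z.1, y) ^ 2)
      ((fderiv ℝ (fun p => inChart F φ p ^ 2) z).comp (ContinuousLinearMap.inr ℝ 𝔼 𝔼)) z.2 :=
    HasFDerivAt.comp (g := fun p => inChart F φ p ^ 2) z.2
      (differentiableAt_of_contDiffOn isOpen_slitDomain
        ((hF.contDiffOn_inChart hφ).pow 2) hz).hasFDerivAt (hasFDerivAt_prodMk_right z.1 z.2)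
  rw [h1, ← h4, h5, h6.fderiv, flat]
  simp only [ContinuousLinearMap.comp_apply, ContinuousLinearMap.inr_apply]
  ring

theorem isSemiBasicOneForm_energyForm (hF : IsFinslerMetric F) (κ : ℝ) :
    IsSemiBasicOneForm (energyForm F κ) where
  smooth φ hφ u := by
    obtain ⟨s, h⟩ := hF.exists_isLocalSpray hφ
    exact (contDiffOn_const.mul (h.contDiffOn_flat u.1)).congr fun z hz =>
      formInChart_energyForm hF hφ κ hz u
  semiBasic z _ u hu := by
    change (κ / 2) * fderiv ℝ (fun v : 𝔼 => F ⟨z.proj, v⟩ ^ 2) z.2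
      (mfderiv (𝓡 n).tangent (𝓡 n) (fun p : TangentBundle (𝓡 n) M => p.proj) z u) = 0
    rw [hu]
    exact mul_eq_zero_of_right _ (map_zero _)

/-- A Finsler metric of constant flag curvature `κ` has `R = (κ / 2) d_J F² ∧ J`. -/
theorem curvatureEqWedge_energyForm (hF : IsFinslerMetric F) (hn : 1 < n) {κ : ℝ}
    (hκ : ∀ φ ∈ IsManifold.maximalAtlas (𝓡 n) ∞ M, ∀ z ∈ slitDomain φ,
      ∀ X : 𝔼, LinearIndependent ℝ ![z.2, X] → flagCurvature (inChart F φ) z X = κ) :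
    CurvatureEqWedge F (energyForm F κ) := by
  intro φ hφ z hz u w
  obtain ⟨s, h⟩ := hF.exists_isLocalSpray hφ
  have hjac := fun p hp => h.jacobi_eq_of_flag hp (fun a ha => hF.hess_inChart_pos hφ hn hp ha)
    hp.2 (fun X hX => by rw [← h.flagCurvature_eq hp, hκ φ hφ p hp X hX])
  rw [h.curvature_eq hz, h.horCurv_eq_of_jacobi hjac hz, formInChart_energyForm hF hφ κ hz,
    formInChart_energyForm hF hφ κ hz]
  ext1
  · simp [vertEndo]
  · simp only [vertEndo, ContinuousLinearMap.comp_apply, ContinuousLinearMap.coe_fst',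
      ContinuousLinearMap.inr_apply, Prod.snd_sub, Prod.smul_snd]
    module

/-- A `1`-form on `TM` in induced coordinates, as a field of continuous linear forms. -/
noncomputable def formInChartL
    (ξ : ∀ z : TangentBundle (𝓡 n) M, TangentSpace (𝓡 n).tangent z →L[ℝ] ℝ)
    (φ : OpenPartialHomeomorph M 𝔼) (z : 𝔼 × 𝔼) : 𝔼 × 𝔼 →L[ℝ] ℝ :=
  (ξ (bundleParam φ z)).comp (mfderiv 𝓘(ℝ, 𝔼 × 𝔼) (𝓡 n).tangent (bundleParam φ) z)

theorem IsSemiBasicOneForm.contDiffOn_formInChartL (hξ : IsSemiBasicOneForm ξ)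
    (hφ : φ ∈ IsManifold.maximalAtlas (𝓡 n) ∞ M) :
    ContDiffOn ℝ ∞ (formInChartL ξ φ) (slitDomain φ) :=
  contDiffOn_clm_apply.mpr (hξ.smooth φ hφ)

/-- The value of a semi-basic form depends only on the projection of the tangent vector. -/
theorem IsSemiBasicOneForm.apply_eq (hξ : IsSemiBasicOneForm ξ) {p : TangentBundle (𝓡 n) M}
    (hp : p.2 ≠ 0) {u w : TangentSpace (𝓡 n).tangent p}
    (huw : mfderiv (𝓡 n).tangent (𝓡 n) (fun p : TangentBundle (𝓡 n) M => p.proj) p u =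
      mfderiv (𝓡 n).tangent (𝓡 n) (fun p : TangentBundle (𝓡 n) M => p.proj) p w) :
    ξ p u = ξ p w := by
  rw [← sub_eq_zero, ← map_sub]
  exact hξ.semiBasic p hp _ (by rw [map_sub, huw, sub_self])

/-- The factor `ρ` in `ξ = (ρ / 2) d_J F²`, namely `ξ(u) / F²` for any `u` that projects to `y`,
such as the spray. This description does not involve coordinates. -/
noncomputable def formRatio (F : TangentBundle (𝓡 n) M → ℝ)
    (ξ : ∀ z : TangentBundle (𝓡 n) M, TangentSpace (𝓡 n).tangent z →L[ℝ] ℝ)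
    (p : TangentBundle (𝓡 n) M) : ℝ :=
  ξ p (Classical.epsilon fun u => mfderiv (𝓡 n).tangent (𝓡 n)
    (fun p : TangentBundle (𝓡 n) M => p.proj) p u = p.2) / F p ^ 2

/-- The factor `ρ` in induced coordinates. -/
noncomputable def chartRatio (F : TangentBundle (𝓡 n) M → ℝ)
    (ξ : ∀ z : TangentBundle (𝓡 n) M, TangentSpace (𝓡 n).tangent z →L[ℝ] ℝ)
    (φ : OpenPartialHomeomorph M 𝔼) (z : 𝔼 × 𝔼) : ℝ :=
  formInChartL ξ φ z (z.2, 0) / inChart F φ z ^ 2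

theorem formRatio_bundleParam (hξ : IsSemiBasicOneForm ξ)
    (hφ : φ ∈ IsManifold.maximalAtlas (𝓡 n) ∞ M) {z : 𝔼 × 𝔼} (hz : z ∈ slitDomain φ) :
    formRatio F ξ (bundleParam φ z) = chartRatio F ξ φ z := by
  have h1 : mfderiv (𝓡 n).tangent (𝓡 n) (fun p : TangentBundle (𝓡 n) M => p.proj)
      (bundleParam φ z) (mfderiv 𝓘(ℝ, 𝔼 × 𝔼) (𝓡 n).tangent (bundleParam φ) z (z.2, 0)) =
      (bundleParam φ z).2 := mfderiv_proj_bundleParam hφ hz.1 (z.2, 0)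
  have h2 := Classical.epsilon_spec (p := fun u => mfderiv (𝓡 n).tangent (𝓡 n)
    (fun p : TangentBundle (𝓡 n) M => p.proj) (bundleParam φ z) u = (bundleParam φ z).2) ⟨_, h1⟩
  rw [formRatio, hξ.apply_eq (bundleParam_snd_ne_zero hφ hz) (h2.trans h1.symm)]
  rfl

theorem contDiffOn_chartRatio (hF : IsFinslerMetric F) (hξ : IsSemiBasicOneForm ξ)
    (hφ : φ ∈ IsManifold.maximalAtlas (𝓡 n) ∞ M) :
    ContDiffOn ℝ ∞ (chartRatio F ξ φ) (slitDomain φ) :=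
  ((hξ.contDiffOn_formInChartL hφ).clm_apply (contDiffOn_snd.prodMk contDiffOn_const)).div
    ((hF.contDiffOn_inChart hφ).pow 2) fun _ hz => (pow_pos (hF.inChart_pos hφ hz) 2).ne'

theorem horCurv_eq_chartRatio (hF : IsFinslerMetric F)
    (hφ : φ ∈ IsManifold.maximalAtlas (𝓡 n) ∞ M) (hR : CurvatureEqWedge F ξ) {s : 𝔼 × 𝔼 → 𝔼}
    (h : IsLocalSpray (fun p => inChart F φ p ^ 2) s (slitDomain φ)) {z : 𝔼 × 𝔼}
    (hz : z ∈ slitDomain φ) (a b : 𝔼) :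
    horCurv s a b z = chartRatio F ξ φ z •
      (flat (fun p => inChart F φ p ^ 2) a z • b - flat (fun p => inChart F φ p ^ 2) b z • a) := by
  have hw (a b : 𝔼) : horCurv s a b z =
      formInChartL ξ φ z (a, 0) • b - formInChartL ξ φ z (b, 0) • a := by
    have h1 := hR φ hφ z hz (a, 0) (b, 0)
    rw [h.curvature_eq hz] at h1
    exact congrArg Prod.snd h1
  have hform := h.form_eq_of_wedge hz (pow_pos (hF.inChart_pos hφ hz) 2).ne'
    (ξ := fun a => formInChartL ξ φ z (a, 0)) hw
  rw [hw, hform a, hform b, chartRatio]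
  module

theorem flagCurvature_eq_chartRatio (hF : IsFinslerMetric F) (hn : 1 < n)
    (hφ : φ ∈ IsManifold.maximalAtlas (𝓡 n) ∞ M) (hR : CurvatureEqWedge F ξ) {z : 𝔼 × 𝔼}
    (hz : z ∈ slitDomain φ) {X : 𝔼} (hX : LinearIndependent ℝ ![z.2, X]) :
    flagCurvature (inChart F φ) z X = chartRatio F ξ φ z := by
  obtain ⟨s, h⟩ := hF.exists_isLocalSpray hφ
  rw [h.flagCurvature_eq hz]
  exact h.flag_eq_of_wedge hz (fun a ha => hF.hess_inChart_pos hφ hn hz ha)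
    (horCurv_eq_chartRatio hF hφ hR h hz) hX

/-- By Schur's lemma every point of `M` has a neighbourhood over which `ρ` is constant. -/
theorem eventually_formRatio_eq (hF : IsFinslerMetric F) (hn : 2 < n) (hξ : IsSemiBasicOneForm ξ)
    (hR : CurvatureEqWedge F ξ) (x : M) :
    ∃ c, ∀ᶠ q in 𝓝 x, ∀ v : TangentSpace (𝓡 n) q, v ≠ 0 → formRatio F ξ ⟨q, v⟩ = c := by
  set φ := chartAt 𝔼 x
  have hφ : φ ∈ IsManifold.maximalAtlas (𝓡 n) ∞ M := IsManifold.chart_mem_maximalAtlas x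
  have hx : x ∈ φ.source := mem_chart_source 𝔼 x
  obtain ⟨s, h⟩ := hF.exists_isLocalSpray hφ
  obtain ⟨r, hr, hball⟩ := Metric.isOpen_iff.mp φ.open_target (φ x) (φ.map_source hx)
  have hsub : Metric.ball (φ x) r ×ˢ ({0}ᶜ : Set 𝔼) ⊆ slitDomain φ :=
    fun z hz => ⟨hball hz.1, hz.2⟩
  have hconn : IsPreconnected (Metric.ball (φ x) r ×ˢ ({0}ᶜ : Set 𝔼)) :=
    (convex_ball _ _).isPreconnected.prod (isConnected_compl_singleton_of_one_lt_rank
      (Module.lt_rank_of_lt_finrank (by simp; omega)) 0).isPreconnected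
  have hsmooth := contDiffOn_chartRatio hF hξ hφ
  obtain ⟨c, hc⟩ := IsOpen.exists_is_const_of_fderiv_eq_zero (𝕜 := ℝ)
    (Metric.isOpen_ball.prod isOpen_compl_singleton) hconn
    ((hsmooth.differentiableOn (by simp)).mono hsub) fun z hz =>
      h.fderiv_eq_zero_of_wedge (by simpa using hn) hsmooth
        (fun p hp => horCurv_eq_chartRatio hF hφ hR h hp)
        (fun p hp => (pow_pos (hF.inChart_pos hφ hp) 2).ne') (hsub hz)
  refine ⟨c, ?_⟩
  filter_upwards [φ.open_source.mem_nhds hx,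
    (φ.continuousAt hx).eventually_mem (Metric.ball_mem_nhds _ hr)] with q hq hqr v hv
  obtain ⟨y, hy⟩ := exists_bundleParam_eq hφ (p := ⟨q, v⟩) hq
  have hy0 : y ≠ 0 := by
    rintro rfl
    have h0 : (bundleParam φ (φ q, (0 : 𝔼))).2 = 0 :=
      map_zero (mfderiv (𝓡 n) (𝓡 n) φ.symm (φ q))
    rw [hy] at h0
    exact hv h0
  have hz : (φ q, y) ∈ Metric.ball (φ x) r ×ˢ ({0}ᶜ : Set 𝔼) := ⟨hqr, hy0⟩
  rw [← hy, formRatio_bundleParam hξ hφ (hsub hz), hc _ hz]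

/-- If `R = ξ ∧ J` then the locally constant flag curvature is constant, `M` being connected. -/
theorem hasConstantFlagCurvature_of_wedge [PreconnectedSpace M] [Nonempty M]
    (hF : IsFinslerMetric F) (hn : 2 < n) (hξ : IsSemiBasicOneForm ξ)
    (hR : CurvatureEqWedge F ξ) : HasConstantFlagCurvature F := by
  have : Nontrivial 𝔼 := Module.nontrivial_of_finrank_pos (R := ℝ) (by simp; omega)
  obtain ⟨v, hv⟩ := exists_ne (0 : 𝔼)
  let K : M → ℝ := fun q => formRatio F ξ ⟨q, v⟩
  have hK (p : TangentBundle (𝓡 n) M) (hp : p.2 ≠ 0) : formRatio F ξ p = K p.proj := by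
    obtain ⟨c, hc⟩ := eventually_formRatio_eq hF hn hξ hR p.proj
    exact (hc.self_of_nhds p.2 hp).trans (hc.self_of_nhds v hv).symm
  have hloc : IsLocallyConstant K := (IsLocallyConstant.iff_eventually_eq K).mpr fun x => by
    obtain ⟨c, hc⟩ := eventually_formRatio_eq hF hn hξ hR x
    filter_upwards [hc] with q hq
    exact (hq v hv).trans (hc.self_of_nhds v hv).symm
  obtain ⟨x⟩ := ‹Nonempty M›
  refine ⟨K x, fun φ hφ z hz X hX => ?_⟩
  rw [flagCurvature_eq_chartRatio hF (by omega) hφ hR hz hX, ← formRatio_bundleParam hξ hφ hz,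
    hK _ (bundleParam_snd_ne_zero hφ hz)]
  exact hloc.apply_eq_of_preconnectedSpace _ _

end Forms

end Finsler

theorem lemma3p1 {n : ℕ} (hn : 2 < n) {M : Type*} [TopologicalSpace M]
    [ChartedSpace (EuclideanSpace ℝ (Fin n)) M] [IsManifold (𝓡 n) ∞ M] [ConnectedSpace M]
    (F : TangentBundle (𝓡 n) M → ℝ) (hF : Finsler.IsFinslerMetric F) :
    Finsler.HasConstantFlagCurvature F ↔
      ∃ ξ : ∀ z : TangentBundle (𝓡 n) M, TangentSpace (𝓡 n).tangent z →L[ℝ] ℝ,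
        Finsler.IsSemiBasicOneForm ξ ∧ Finsler.CurvatureEqWedge F ξ := by
  constructor
  · rintro ⟨κ, hκ⟩
    exact ⟨Finsler.energyForm F κ, Finsler.isSemiBasicOneForm_energyForm hF κ,
      Finsler.curvatureEqWedge_energyForm hF (by omega) hκ⟩
  · rintro ⟨ξ, hξ, hR⟩
    exact Finsler.hasConstantFlagCurvature_of_wedge hF hn hξ hR
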